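/- Let $G$ be a finite group. A Mackey functor $M$ for $G$ consists of abelian groups $M(H)$ ($H\le G$) with restriction maps $\mathrm{res}^H_K$, induction maps $\mathrm{ind}^H_K$ ($K\le H$) and conjugation maps $c_{g,H}\colon M(H)\to M(gHg^{-1})$ satisfying the usual relations (functoriality, $c_{h,H}=\mathrm{id}$ for $h\in H$, compatibility of conjugation with restriction and induction, Mackey double coset formula). A Green functor $R$ for $G$ is a Mackey functor whose values are (associative, unital) rings, whose restriction and conjugation maps are ring homomorphisms, and which satisfies the Frobenius relations $\mathrm{ind}^H_K(\mathrm{res}^H_K(r)\,r')=r\,\mathrm{ind}^H_K(r')$ and $\mathrm{ind}^H_K(r\,\mathrm{res}^H_K(r'))=\mathrm{ind}^H_K(r)\,r'$. A (left) Mackey $R$-module is a Mackey functor $M$ with a left $R(H)$-module structure on each $M(H)$, satisfying the analogous Frobenius relations and such that restrictions and conjugations are compatible with the actions; with the $R$-linear morphisms of Mackey functors these form the category $R\text{-}\mathrm{Mack}(G)$. For $H\le G$ let $W_G(H)=N_G(H)/H$ and let $\overline M(H)=M(H)/\sum_{K<H}\mathrm{ind}_K^H(M(K))$ be the Brauer quotient.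 Then $\overline R(H)$ is a ring on which $W_G(H)$ acts by conjugation $c$, and $\overline M(H)$, with the conjugation action of $W_G(H)$, is a left module over the skew group ring $\overline R(H)\rtimes_c W_G(H)$; this defines a functor $\mathrm{Br}_H\colon R\text{-}\mathrm{Mack}(G)\to \overline R(H)\rtimes_c W_G(H)\text{-}\mathrm{Mod}$. **Theorem.** Let $G$ be a finite group and $R$ a Green functor for $G$. Let $\mathrm{Cl}(H)$ run through the conjugacy classes of subgroups of $G$, with one representative $H$ chosen in each. Then the functor $$\mathrm{Br}=(\mathrm{Br}_H)_{\mathrm{Cl}(H)}\colon R\text{-}\mathrm{Mack}(G)\longrightarrow \prod_{\mathrm{Cl}(H)}\overline R(H)\rtimes_c W_G(H)\text{-}\mathrm{Mod}$$ has a right adjoint $\Phi$. Moreover, for every subring $Q\subseteq\mathbb Q$ containing $|G|^{-1}$, with $R_Q$ the Green functor $R_Q(H)=Q\otimes_{\mathbb Z}R(H)$, the adjunction $(\mathrm{Br},\Phi)$ induces an adjoint equivalence $$R_Q\text{-}\mathrm{Mack}(G)\simeq\prod_{\mathrm{Cl}(H)}Q\otimes_{\mathbb Z}\big(\overline R(H)\rtimes_c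 W_G(H)\big)\text{-}\mathrm{Mod}.$$ That is, there is an adjoint equivalence between these two categories whose two functors correspond, up to natural isomorphism, to $\mathrm{Br}$ and $\Phi$ under restriction of the actions along $R\to R_Q$ and along $\overline R(H)\rtimes_c W_G(H)\to Q\otimes_{\mathbb Z}(\overline R(H)\rtimes_c W_G(H))$, and whose unit and counit correspond under these isomorphisms to those of the adjunction $\mathrm{Br}\dashv\Phi$. -/

import Mathlib

open CategoryTheory
open scoped Pointwise TensorProduct

universe u v w

/-- The structure of a Mackey functor for `G` on a family of abelian groups `M H`, `H ≤ G`
(subgroups picture). Here `ᵍH = gHg⁻¹` is `MulAut.conj g • H`. The conjugation map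
`c_{g,H} : M H → M (ᵍH)` is recorded as a map `M H → M K` for every `K` equal to `ᵍH`; this is
no extra datum. -/
structure MackeyStructure (G : Type u) [Group G] (M : Subgroup G → Type v)
    [∀ H, AddCommGroup (M H)] where
  /-- restriction `res^H_K` -/
  res : ∀ {K H : Subgroup G}, K ≤ H → (M H →+ M K)
  /-- induction `ind^H_K` -/
  ind : ∀ {K H : Subgroup G}, K ≤ H → (M K →+ M H)
  /-- conjugation `c_{g,H}` -/
  conj : ∀ (g : G) {H K : Subgroup G}, MulAut.conj g • H = K → (M H →+ M K)
  res_self : ∀ {H : Subgroup G} (h : H ≤ H) (m : M H), res h m = m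
  ind_self : ∀ {H : Subgroup G} (h : H ≤ H) (m : M H), ind h m = m
  res_res : ∀ {L K H : Subgroup G} (hL : L ≤ K) (hK : K ≤ H) (m : M H),
    res hL (res hK m) = res (hL.trans hK) m
  ind_ind : ∀ {L K H : Subgroup G} (hL : L ≤ K) (hK : K ≤ H) (m : M L),
    ind hK (ind hL m) = ind (hL.trans hK) m
  conj_of_mem : ∀ {H : Subgroup G} (g : G) (_ : g ∈ H) (h : MulAut.conj g • H = H) (m : M H),
    conj g h m = m
  conj_conj : ∀ (g g' : G) {H K L : Subgroup G} (h : MulAut.conj g • H = K)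
    (h' : MulAut.conj g' • K = L) (h'' : MulAut.conj (g' * g) • H = L) (m : M H),
    conj g' h' (conj g h m) = conj (g' * g) h'' m
  conj_res : ∀ (g : G) {K H K' H' : Subgroup G} (hKH : K ≤ H) (hKH' : K' ≤ H')
    (hK : MulAut.conj g • K = K') (hH : MulAut.conj g • H = H') (m : M H),
    conj g hK (res hKH m) = res hKH' (conj g hH m)
  conj_ind : ∀ (g : G) {K H K' H' : Subgroup G} (hKH : K ≤ H) (hKH' : K' ≤ H')
    (hK : MulAut.conj g • K = K') (hH : MulAut.conj g • H = H') (m : M K),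
    conj g hH (ind hKH m) = ind hKH' (conj g hK m)
  /-- the Mackey formula
  `res^H_K ind^H_L = ∑_{x ∈ K \ H / L} ind^K_{K ∩ ˣL} res^{ˣL}_{K ∩ ˣL} c_x` -/
  res_ind : ∀ {K L H : Subgroup G} (hK : K ≤ H) (hL : L ≤ H) (m : M L),
    res hK (ind hL m) =
      ∑ᶠ x : DoubleCoset.Quotient (K.subgroupOf H : Set H) (L.subgroupOf H : Set H),
        ind (inf_le_left : K ⊓ MulAut.conj ((Quotient.out x : H) : G) • L ≤ K)
          (res inf_le_right (conj ((Quotient.out x : H) : G) rfl m))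

namespace MackeyStructure

variable {G : Type u} [Group G] {M : Subgroup G → Type v} [∀ H, AddCommGroup (M H)]

/-- The sum of the images of the induction maps `ind_K^H` over all proper subgroups `K < H`. -/
def inducedSubgroup (S : MackeyStructure G M) (H : Subgroup G) : AddSubgroup (M H) :=
  ⨆ (K : Subgroup G) (h : K < H), (S.ind h.le).range

theorem ind_mem_inducedSubgroup (S : MackeyStructure G M) {K H : Subgroup G} (h : K < H)
    (m : M K) : S.ind h.le m ∈ S.inducedSubgroup H := by
  have h1 : (S.ind h.le).range ≤ S.inducedSubgroup H :=
    le_iSup₂_of_le (f := fun (K : Subgroup G) (h : K < H) => (S.ind h.le).range) K h le_rfl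
  exact h1 ⟨m, rfl⟩

theorem inducedSubgroup_le (S : MackeyStructure G M) {H : Subgroup G} {A : AddSubgroup (M H)}
    (hA : ∀ (K : Subgroup G) (h : K < H) (m : M K), S.ind h.le m ∈ A) :
    S.inducedSubgroup H ≤ A := by
  refine iSup₂_le fun K h => ?_
  rintro _ ⟨m, rfl⟩
  exact hA K h m

theorem conj_mem_inducedSubgroup (S : MackeyStructure G M) (g : G) {H H' : Subgroup G}
    (h : MulAut.conj g • H = H') {m : M H} (hm : m ∈ S.inducedSubgroup H) :
    S.conj g h m ∈ S.inducedSubgroup H' := by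
  have h1 : S.inducedSubgroup H ≤ (S.inducedSubgroup H').comap (S.conj g h) := by
    refine S.inducedSubgroup_le fun K hK m => ?_
    have hlt : MulAut.conj g • K < H' := by
      subst h
      refine lt_of_le_of_ne (Subgroup.pointwise_smul_le_pointwise_smul_iff.2 hK.le) ?_
      intro he
      exact hK.ne (smul_left_cancel _ he)
    rw [AddSubgroup.mem_comap, S.conj_ind g hK.le hlt.le rfl h m]
    exact S.ind_mem_inducedSubgroup hlt _
  exact h1 hm

end MackeyStructure

/-- A Green functor for `G`. -/
structure GreenFunctor (G : Type u) [Group G] where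
  obj : Subgroup G → Type w
  [ring : ∀ H, Ring (obj H)]
  str : MackeyStructure G obj
  res_one : ∀ {K H : Subgroup G} (h : K ≤ H), str.res h 1 = 1
  res_mul : ∀ {K H : Subgroup G} (h : K ≤ H) (r s : obj H),
    str.res h (r * s) = str.res h r * str.res h s
  conj_one : ∀ (g : G) {H K : Subgroup G} (h : MulAut.conj g • H = K), str.conj g h 1 = 1
  conj_mul : ∀ (g : G) {H K : Subgroup G} (h : MulAut.conj g • H = K) (r s : obj H),
    str.conj g h (r * s) = str.conj g h r * str.conj g h s
  ind_res_mul : ∀ {K H : Subgroup G} (h : K ≤ H) (r : obj H) (s : obj K),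
    str.ind h (str.res h r * s) = r * str.ind h s
  ind_mul_res : ∀ {K H : Subgroup G} (h : K ≤ H) (r : obj K) (s : obj H),
    str.ind h (r * str.res h s) = str.ind h r * s

attribute [instance] GreenFunctor.ring

/-- A (left) Mackey module over the Green functor `R`. -/
structure MackeyModule {G : Type u} [Group G] (R : GreenFunctor.{u, w} G) where
  obj : Subgroup G → Type v
  [addCommGroup : ∀ H, AddCommGroup (obj H)]
  [module : ∀ H, Module (R.obj H) (obj H)]
  str : MackeyStructure G obj
  res_smul : ∀ {K H : Subgroup G} (h : K ≤ H) (r : R.obj H) (m : obj H),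
    str.res h (r • m) = R.str.res h r • str.res h m
  conj_smul : ∀ (g : G) {H K : Subgroup G} (h : MulAut.conj g • H = K) (r : R.obj H) (m : obj H),
    str.conj g h (r • m) = R.str.conj g h r • str.conj g h m
  ind_res_smul : ∀ {K H : Subgroup G} (h : K ≤ H) (r : R.obj H) (m : obj K),
    str.ind h (R.str.res h r • m) = r • str.ind h m
  ind_smul_res : ∀ {K H : Subgroup G} (h : K ≤ H) (r : R.obj K) (m : obj H),
    str.ind h (r • str.res h m) = R.str.ind h r • m

attribute [instance] MackeyModule.addCommGroup MackeyModule.module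

namespace MackeyModule

variable {G : Type u} [Group G] {R : GreenFunctor.{u, w} G}

/-- A morphism of Mackey `R`-modules: `R(H)`-linear maps commuting with restrictions, inductions
and conjugations. -/
@[ext]
structure Hom (M N : MackeyModule.{u, v, w} R) where
  app : ∀ H : Subgroup G, M.obj H →ₗ[R.obj H] N.obj H
  app_res : ∀ {K H : Subgroup G} (h : K ≤ H) (m : M.obj H),
    app K (M.str.res h m) = N.str.res h (app H m)
  app_ind : ∀ {K H : Subgroup G} (h : K ≤ H) (m : M.obj K),
    app H (M.str.ind h m) = N.str.ind h (app K m)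
  app_conj : ∀ (g : G) {H K : Subgroup G} (h : MulAut.conj g • H = K) (m : M.obj H),
    app K (M.str.conj g h m) = N.str.conj g h (app H m)

instance : Category (MackeyModule.{u, v, w} R) where
  Hom M N := Hom M N
  id M :=
    { app := fun _ => LinearMap.id
      app_res := fun _ _ => rfl
      app_ind := fun _ _ => rfl
      app_conj := fun _ _ _ _ _ => rfl }
  comp f g :=
    { app := fun H => (g.app H).comp (f.app H)
      app_res := fun h m => by simp [f.app_res, g.app_res]
      app_ind := fun h m => by simp [f.app_ind, g.app_ind]
      app_conj := fun x _ _ h m => by simp [f.app_conj, g.app_conj] }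

end MackeyModule

/-- The Weyl group `W_G(H) = N_G(H) / H`. -/
abbrev WeylGroup {G : Type u} [Group G] (H : Subgroup G) : Type u :=
  Subgroup.normalizer (H : Set G) ⧸ H.subgroupOf (Subgroup.normalizer (H : Set G))

theorem conj_smul_eq_of_mem_normalizer {G : Type u} [Group G] {H : Subgroup G}
    (n : Subgroup.normalizer (H : Set G)) : MulAut.conj (n : G) • H = H := by
  apply SetLike.coe_injective
  rw [Subgroup.coe_pointwise_smul]
  exact Subgroup.mem_normalizer_iff_conj_image_eq.1 n.2

namespace GreenFunctor

variable {G : Type u} [Group G] (R : GreenFunctor.{u, w} G) (H : Subgroup G)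

/-- The ideal of `R(H)` of sums of elements induced from proper subgroups. -/
def brauerIdeal : Ideal (R.obj H) where
  __ := R.str.inducedSubgroup H
  smul_mem' r x hx := by
    have h1 : R.str.inducedSubgroup H ≤
        (R.str.inducedSubgroup H).comap (AddMonoidHom.mulLeft r) := by
      refine R.str.inducedSubgroup_le fun K h m => ?_
      rw [AddSubgroup.mem_comap, AddMonoidHom.coe_mulLeft, ← R.ind_res_mul]
      exact R.str.ind_mem_inducedSubgroup h _
    exact h1 hx

theorem mem_brauerIdeal {x : R.obj H} : x ∈ R.brauerIdeal H ↔ x ∈ R.str.inducedSubgroup H :=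
  Iff.rfl

instance : (R.brauerIdeal H).IsTwoSided where
  mul_mem_of_left {x} r hx := by
    have h1 : R.str.inducedSubgroup H ≤
        (R.str.inducedSubgroup H).comap (AddMonoidHom.mulRight r) := by
      refine R.str.inducedSubgroup_le fun K h m => ?_
      rw [AddSubgroup.mem_comap, AddMonoidHom.mulRight_apply, ← R.ind_mul_res]
      exact R.str.ind_mem_inducedSubgroup h _
    exact h1 hx

/-- The Brauer quotient ring of `R` at `H`. -/
abbrev brauerQuotient : Type w := R.obj H ⧸ R.brauerIdeal H

variable {H} in
/-- The conjugation `c_n : R(H) → R(H)` for `n ∈ N_G(H)`. -/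
def conjRingHom (n : Subgroup.normalizer (H : Set G)) : R.obj H →+* R.obj H where
  __ := R.str.conj (n : G) (conj_smul_eq_of_mem_normalizer n)
  map_one' := R.conj_one _ _
  map_mul' := R.conj_mul _ _

/-- The conjugation action of `N_G(H)` on the Brauer quotient ring. -/
def normalizerAction :
    Subgroup.normalizer (H : Set G) →* (R.brauerQuotient H →+* R.brauerQuotient H) where
  toFun n := Ideal.quotientMap (R.brauerIdeal H) (R.conjRingHom n)
    (fun _ hx => R.str.conj_mem_inducedSubgroup _ _ hx)
  map_one' := by
    refine Ideal.Quotient.ringHom_ext (RingHom.ext fun x => ?_)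
    exact congrArg (Ideal.Quotient.mk (R.brauerIdeal H))
      (R.str.conj_of_mem _ (one_mem H) _ x)
  map_mul' n n' := by
    refine Ideal.Quotient.ringHom_ext (RingHom.ext fun x => ?_)
    exact congrArg (Ideal.Quotient.mk (R.brauerIdeal H)) (R.str.conj_conj _ _ _ _ _ x).symm

/-- The conjugation action of `W_G(H)` on the Brauer quotient ring. -/
def weylAction : WeylGroup H →* (R.brauerQuotient H →+* R.brauerQuotient H) :=
  QuotientGroup.lift _ (R.normalizerAction H) fun n hn => by
    refine Ideal.Quotient.ringHom_ext (RingHom.ext fun x => ?_)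
    exact congrArg (Ideal.Quotient.mk (R.brauerIdeal H)) (R.str.conj_of_mem _ hn _ x)

instance : MulSemiringAction (WeylGroup H) (R.brauerQuotient H) :=
  MulSemiringAction.compHom _ (R.weylAction H)

/-- The skew group ring of `W_G(H)` over the Brauer quotient ring of `R` at `H`, for the
conjugation action. -/
def skewRing : Type (max u w) := SkewMonoidAlgebra (R.brauerQuotient H) (WeylGroup H)

noncomputable instance : Ring (R.skewRing H) :=
  inferInstanceAs (Ring (SkewMonoidAlgebra (R.brauerQuotient H) (WeylGroup H)))

variable {H} in
/-- The element `s w` of the skew group ring. -/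
noncomputable def skewSingle (s : R.brauerQuotient H) (y : WeylGroup H) : R.skewRing H :=
  SkewMonoidAlgebra.single y s

variable {H} in
theorem skewRing_induction {p : R.skewRing H → Prop} (a : R.skewRing H) (zero : p 0)
    (single : ∀ s y, p (R.skewSingle s y)) (add : ∀ a b, p a → p b → p (a + b)) : p a :=
  SkewMonoidAlgebra.induction_on (p := p) a zero (fun y s => single s y) add

end GreenFunctor

namespace MackeyModule

variable {G : Type u} [Group G] {R : GreenFunctor.{u, w} G} (M : MackeyModule.{u, v, w} R)
  (H : Subgroup G)

/-- The `R(H)`-submodule of `M(H)` of sums of elements induced from proper subgroups. -/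
def brauerSubmodule : Submodule (R.obj H) (M.obj H) where
  __ := M.str.inducedSubgroup H
  smul_mem' r x hx := by
    have h1 : M.str.inducedSubgroup H ≤
        (M.str.inducedSubgroup H).comap (DistribSMul.toAddMonoidHom (M.obj H) r) := by
      refine M.str.inducedSubgroup_le fun K h m => ?_
      rw [AddSubgroup.mem_comap, DistribSMul.toAddMonoidHom_apply, ← M.ind_res_smul]
      exact M.str.ind_mem_inducedSubgroup h _
    exact h1 hx

/-- The Brauer quotient of `M` at `H`. -/
abbrev brauerQuotient : Type v := M.obj H ⧸ M.brauerSubmodule H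

theorem brauerQuotient_isTorsionBySet :
    Module.IsTorsionBySet (R.obj H) (M.brauerQuotient H) (R.brauerIdeal H : Set (R.obj H)) := by
  intro x r
  obtain ⟨m, rfl⟩ := Submodule.Quotient.mk_surjective _ x
  rw [← Submodule.Quotient.mk_smul, Submodule.Quotient.mk_eq_zero]
  have h1 : R.str.inducedSubgroup H ≤ (M.str.inducedSubgroup H).comap
      ((smulAddHom (R.obj H) (M.obj H)).flip m) := by
    refine R.str.inducedSubgroup_le fun K h r => ?_
    rw [AddSubgroup.mem_comap, AddMonoidHom.flip_apply, smulAddHom_apply, ← M.ind_smul_res]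
    exact M.str.ind_mem_inducedSubgroup h _
  exact h1 r.2

/-- The Brauer quotient of `M` at `H` as a module over the Brauer quotient ring of `R`. -/
instance : Module (R.brauerQuotient H) (M.brauerQuotient H) :=
  (M.brauerQuotient_isTorsionBySet H).module

variable {H} in
/-- The conjugation `c_n : M(H) → M(H)` for `n ∈ N_G(H)`, semilinear over `c_n : R(H) → R(H)`. -/
def conjMap (n : Subgroup.normalizer (H : Set G)) :
    M.obj H →ₛₗ[R.conjRingHom n] M.obj H where
  __ := M.str.conj (n : G) (conj_smul_eq_of_mem_normalizer n)
  map_smul' := M.conj_smul _ _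

/-- The conjugation action of `N_G(H)` on the Brauer quotient. -/
def normalizerAction :
    Subgroup.normalizer (H : Set G) →* AddMonoid.End (M.brauerQuotient H) where
  toFun n := ((M.brauerSubmodule H).mapQ (M.brauerSubmodule H) (M.conjMap n)
    (fun _ hx => M.str.conj_mem_inducedSubgroup _ _ hx)).toAddMonoidHom
  map_one' := by
    refine AddMonoidHom.ext fun x => ?_
    obtain ⟨m, rfl⟩ := Submodule.Quotient.mk_surjective _ x
    exact congrArg (Submodule.Quotient.mk (p := M.brauerSubmodule H))
      (M.str.conj_of_mem _ (one_mem H) _ m)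
  map_mul' n n' := by
    refine AddMonoidHom.ext fun x => ?_
    obtain ⟨m, rfl⟩ := Submodule.Quotient.mk_surjective _ x
    exact congrArg (Submodule.Quotient.mk (p := M.brauerSubmodule H))
      (M.str.conj_conj _ _ _ _ _ m).symm

/-- The conjugation action of `W_G(H)` on the Brauer quotient. -/
def weylAction : WeylGroup H →* AddMonoid.End (M.brauerQuotient H) :=
  QuotientGroup.lift _ (M.normalizerAction H) fun n hn => by
    refine AddMonoidHom.ext fun x => ?_
    obtain ⟨m, rfl⟩ := Submodule.Quotient.mk_surjective _ x
    exact congrArg (Submodule.Quotient.mk (p := M.brauerSubmodule H))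
      (M.str.conj_of_mem _ hn _ m)

theorem weylAction_smul (y : WeylGroup H) (s : R.brauerQuotient H) (x : M.brauerQuotient H) :
    M.weylAction H y (s • x) = (y • s) • M.weylAction H y x := by
  obtain ⟨n, rfl⟩ := QuotientGroup.mk_surjective y
  obtain ⟨r, rfl⟩ := Ideal.Quotient.mk_surjective s
  obtain ⟨m, rfl⟩ := Submodule.Quotient.mk_surjective _ x
  exact congrArg (Submodule.Quotient.mk (p := M.brauerSubmodule H)) (M.conj_smul _ _ r m)

/-- The action of the skew group ring on the Brauer quotient of `M` at `H`, combining the action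
of the Brauer quotient ring of `R` with the conjugation action of `W_G(H)`. -/
noncomputable def skewAction : R.skewRing H →+* AddMonoid.End (M.brauerQuotient H) :=
  SkewMonoidAlgebra.liftNCRingHom
    (Module.toAddMonoidEnd (R.brauerQuotient H) (M.brauerQuotient H)) (M.weylAction H)
    (fun {x y} => AddMonoidHom.ext fun m => (M.weylAction_smul H y x m).symm)

noncomputable instance : Module (R.skewRing H) (M.brauerQuotient H) :=
  Module.compHom _ (M.skewAction H)

theorem skewSingle_smul (y : WeylGroup H) (s : R.brauerQuotient H) (x : M.brauerQuotient H) :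
    R.skewSingle s y • x = s • M.weylAction H y x := by
  change M.skewAction H (R.skewSingle s y) x = _
  have h1 : M.skewAction H (R.skewSingle s y) =
      Module.toAddMonoidEnd (R.brauerQuotient H) (M.brauerQuotient H) s * M.weylAction H y :=
    SkewMonoidAlgebra.liftNC_single _ _ _ _
  rw [h1]
  rfl

variable {M} in
/-- The map induced on Brauer quotients at `H` by a morphism of Mackey `R`-modules. -/
noncomputable def Hom.brauerMap {N : MackeyModule.{u, v, w} R} (f : Hom M N) :
    M.brauerQuotient H →ₗ[R.skewRing H] N.brauerQuotient H :=
  let φ : M.brauerQuotient H →ₗ[R.obj H] N.brauerQuotient H :=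
    (M.brauerSubmodule H).mapQ (N.brauerSubmodule H) (f.app H) (fun x hx => by
      have h1 : M.str.inducedSubgroup H ≤
          (N.str.inducedSubgroup H).comap (f.app H).toAddMonoidHom := by
        refine M.str.inducedSubgroup_le fun K h m => ?_
        rw [AddSubgroup.mem_comap]
        change f.app H _ ∈ _
        rw [f.app_ind]
        exact N.str.ind_mem_inducedSubgroup h _
      exact h1 hx)
  { toFun := φ
    map_add' := φ.map_add
    map_smul' := fun a x => by
      obtain ⟨m, rfl⟩ := Submodule.Quotient.mk_surjective _ x
      induction a using R.skewRing_induction with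
      | zero => rw [zero_smul, map_zero, map_zero, zero_smul]
      | add a b ha hb =>
        simp only [RingHom.id_apply] at ha hb ⊢
        rw [add_smul, map_add, ha, hb, add_smul]
      | single s y =>
        obtain ⟨n, rfl⟩ := QuotientGroup.mk_surjective y
        obtain ⟨r, rfl⟩ := Ideal.Quotient.mk_surjective s
        rw [RingHom.id_apply, skewSingle_smul, skewSingle_smul]
        refine congrArg (Submodule.Quotient.mk (p := N.brauerSubmodule H))
          (a₁ := f.app H (r • M.str.conj n (conj_smul_eq_of_mem_normalizer n) m))
          (a₂ := r • N.str.conj n (conj_smul_eq_of_mem_normalizer n) (f.app H m)) ?_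
        rw [map_smul, f.app_conj] }

/-- The functor `Br_H`, sending `M` to its Brauer quotient at `H`. -/
noncomputable def brauerAt (R : GreenFunctor.{u, w} G) (H : Subgroup G) :
    MackeyModule.{u, v, w} R ⥤ ModuleCat.{v} (R.skewRing H) where
  obj M := ModuleCat.of (R.skewRing H) (M.brauerQuotient H)
  map {M N} f := ModuleCat.ofHom (X := M.brauerQuotient H) (Y := N.brauerQuotient H)
    (Hom.brauerMap H f)
  map_id M := by
    refine ModuleCat.hom_ext (LinearMap.ext fun x => ?_)
    obtain ⟨m, rfl⟩ := Submodule.Quotient.mk_surjective (M.brauerSubmodule H) x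
    rfl
  map_comp {M N P} f g := by
    refine ModuleCat.hom_ext (LinearMap.ext fun x => ?_)
    obtain ⟨m, rfl⟩ := Submodule.Quotient.mk_surjective (M.brauerSubmodule H) x
    rfl

/-- The functor `Br = (Br_H)_{H ∈ T}`, for a set `T` of subgroups of `G`. -/
noncomputable def brauer (R : GreenFunctor.{u, w} G) (T : Set (Subgroup G)) :
    MackeyModule.{u, v, w} R ⥤ (∀ H : T, ModuleCat.{v} (R.skewRing (H : Subgroup G))) :=
  Functor.pi' fun H : T => brauerAt R (H : Subgroup G)

end MackeyModule

/-- Extension of scalars `Q ⊗ f : Q ⊗ A → Q ⊗ B` of a homomorphism of abelian groups. -/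
def tensorMap (Q : Type*) [AddCommGroup Q] {A B : Type*} [AddCommGroup A] [AddCommGroup B]
    (f : A →+ B) : Q ⊗[ℤ] A →+ Q ⊗[ℤ] B :=
  (f.toIntLinearMap.lTensor Q).toAddMonoidHom

theorem tensorMap_tmul (Q : Type*) [AddCommGroup Q] {A B : Type*} [AddCommGroup A]
    [AddCommGroup B] (f : A →+ B) (q : Q) (a : A) : tensorMap Q f (q ⊗ₜ a) = q ⊗ₜ f a := rfl

theorem tensorMap_mul (Q : Type*) [CommRing Q] {A B : Type*} [Ring A] [Ring B] (f : A →+ B)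
    (hf : ∀ a b, f (a * b) = f a * f b) (x y : Q ⊗[ℤ] A) :
    tensorMap Q f (x * y) = tensorMap Q f x * tensorMap Q f y := by
  induction x with
  | zero => simp only [map_zero, zero_mul]
  | add a b ha hb => simp only [map_add, add_mul, ha, hb]
  | tmul q r =>
    induction y with
    | zero => simp only [map_zero, mul_zero]
    | add a b ha hb => simp only [map_add, mul_add, ha, hb]
    | tmul q' s => simp only [tensorMap_tmul, Algebra.TensorProduct.tmul_mul_tmul, hf]

/-- The Mackey functor `Q ⊗ M`, with `(Q ⊗ M)(H) = Q ⊗ M(H)`. -/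
def MackeyStructure.tensor {G : Type u} [Group G] [Finite G] {M : Subgroup G → Type v}
    [∀ H, AddCommGroup (M H)] (Q : Type) [AddCommGroup Q] (S : MackeyStructure G M) :
    MackeyStructure G (fun H => Q ⊗[ℤ] M H) where
  res h := tensorMap Q (S.res h)
  ind h := tensorMap Q (S.ind h)
  conj g _ _ h := tensorMap Q (S.conj g h)
  res_self h m := by
    induction m with
    | zero => simp
    | add a b ha hb => rw [map_add, ha, hb]
    | tmul q m => simp only [tensorMap_tmul, S.res_self]
  ind_self h m := by
    induction m with
    | zero => simp
    | add a b ha hb => rw [map_add, ha, hb]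
    | tmul q m => simp only [tensorMap_tmul, S.ind_self]
  res_res hL hK m := by
    induction m with
    | zero => simp
    | add a b ha hb => simp only [map_add, ha, hb]
    | tmul q m => simp only [tensorMap_tmul, S.res_res]
  ind_ind hL hK m := by
    induction m with
    | zero => simp
    | add a b ha hb => simp only [map_add, ha, hb]
    | tmul q m => simp only [tensorMap_tmul, S.ind_ind]
  conj_of_mem g hg h m := by
    induction m with
    | zero => simp
    | add a b ha hb => rw [map_add, ha, hb]
    | tmul q m => simp only [tensorMap_tmul, S.conj_of_mem g hg]
  conj_conj g g' _ _ _ h h' h'' m := by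
    induction m with
    | zero => simp
    | add a b ha hb => simp only [map_add, ha, hb]
    | tmul q m => simp only [tensorMap_tmul, S.conj_conj g g' h h' h'']
  conj_res g _ _ _ _ hKH hKH' hK hH m := by
    induction m with
    | zero => simp
    | add a b ha hb => simp only [map_add, ha, hb]
    | tmul q m => simp only [tensorMap_tmul, S.conj_res g hKH hKH' hK hH]
  conj_ind g _ _ _ _ hKH hKH' hK hH m := by
    induction m with
    | zero => simp
    | add a b ha hb => simp only [map_add, ha, hb]
    | tmul q m => simp only [tensorMap_tmul, S.conj_ind g hKH hKH' hK hH]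
  res_ind {K L H} hK hL m := by
    have : Finite (DoubleCoset.Quotient (K.subgroupOf H : Set H) (L.subgroupOf H : Set H)) :=
      Quotient.finite _
    have := Fintype.ofFinite
      (DoubleCoset.Quotient (K.subgroupOf H : Set H) (L.subgroupOf H : Set H))
    induction m with
    | zero => simp
    | add a b ha hb =>
      simp only [finsum_eq_sum_of_fintype] at ha hb ⊢
      simp only [map_add, ha, hb, Finset.sum_add_distrib]
    | tmul q m =>
      simp only [finsum_eq_sum_of_fintype, tensorMap_tmul, S.res_ind hK hL,
        TensorProduct.tmul_sum]

namespace GreenFunctor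

variable {G : Type u} [Group G] [Finite G] (R : GreenFunctor.{u, w} G) (Q : Subring ℚ)

/-- The Green functor `R_Q`, with `R_Q(H) = Q ⊗ R(H)`. -/
def baseChange : GreenFunctor.{u, w} G where
  obj H := Q ⊗[ℤ] R.obj H
  ring H := inferInstance
  str := R.str.tensor Q
  res_one h := congrArg (fun x => (1 : Q) ⊗ₜ[ℤ] x) (R.res_one h)
  res_mul h := tensorMap_mul Q _ (R.res_mul h)
  conj_one g _ _ h := congrArg (fun x => (1 : Q) ⊗ₜ[ℤ] x) (R.conj_one g h)
  conj_mul g _ _ h := tensorMap_mul Q _ (R.conj_mul g h)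
  ind_res_mul h r s := by
    change tensorMap Q (R.str.ind h) (tensorMap Q (R.str.res h) r * s) =
      r * tensorMap Q (R.str.ind h) s
    induction r with
    | zero => simp only [map_zero, zero_mul]
    | add a b ha hb => simp only [map_add, add_mul, ha, hb]
    | tmul q r =>
      induction s with
      | zero => simp only [map_zero, mul_zero]
      | add a b ha hb => simp only [map_add, mul_add, ha, hb]
      | tmul q' s =>
        simp only [tensorMap_tmul, Algebra.TensorProduct.tmul_mul_tmul, R.ind_res_mul]
  ind_mul_res h r s := by
    change tensorMap Q (R.str.ind h) (r * tensorMap Q (R.str.res h) s) =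
      tensorMap Q (R.str.ind h) r * s
    induction r with
    | zero => simp only [map_zero, zero_mul]
    | add a b ha hb => simp only [map_add, add_mul, ha, hb]
    | tmul q r =>
      induction s with
      | zero => simp only [map_zero, mul_zero]
      | add a b ha hb => simp only [map_add, mul_add, ha, hb]
      | tmul q' s =>
        simp only [tensorMap_tmul, Algebra.TensorProduct.tmul_mul_tmul, R.ind_mul_res]

/-- The canonical ring homomorphism `R(H) → R_Q(H)`. -/
def toBaseChange (H : Subgroup G) : R.obj H →+* (R.baseChange Q).obj H :=
  (Algebra.TensorProduct.includeRight : R.obj H →ₐ[ℤ] Q ⊗[ℤ] R.obj H).toRingHom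

/-- A Mackey `R_Q`-module regarded as a Mackey `R`-module. -/
def restrictModule (M : MackeyModule.{u, v, w} (R.baseChange Q)) : MackeyModule.{u, v, w} R where
  obj := M.obj
  module H := Module.compHom (M.obj H) (R.toBaseChange Q H)
  str := M.str
  res_smul h r m := M.res_smul h (R.toBaseChange Q _ r) m
  conj_smul g _ _ h r m := M.conj_smul g h (R.toBaseChange Q _ r) m
  ind_res_smul h r m := M.ind_res_smul h (R.toBaseChange Q _ r) m
  ind_smul_res h r m := M.ind_smul_res h (R.toBaseChange Q _ r) m

/-- The functor `R_Q-Mack → R-Mack` restricting the action along `R → R_Q`. -/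
def restrictMackey : MackeyModule.{u, v, w} (R.baseChange Q) ⥤ MackeyModule.{u, v, w} R where
  obj M := R.restrictModule Q M
  map f :=
    { app := fun H =>
        { toFun := f.app H
          map_add' := (f.app H).map_add
          map_smul' := fun r m => (f.app H).map_smul (R.toBaseChange Q H r) m }
      app_res := f.app_res
      app_ind := f.app_ind
      app_conj := f.app_conj }

/-- The ring `Q ⊗ (R̄(H) ⋊ W_G(H))`. -/
abbrev skewRingBaseChange (H : Subgroup G) : Type (max u w) := Q ⊗[ℤ] R.skewRing H

/-- Restriction of scalars along `R̄(H) ⋊ W_G(H) → Q ⊗ (R̄(H) ⋊ W_G(H))`, for all `H ∈ T`. -/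
noncomputable def restrictSkew (T : Set (Subgroup G)) :
    (∀ H : T, ModuleCat.{v} (R.skewRingBaseChange Q (H : Subgroup G))) ⥤
      (∀ H : T, ModuleCat.{v} (R.skewRing (H : Subgroup G))) :=
  Functor.pi fun H : T => ModuleCat.restrictScalars
    (Algebra.TensorProduct.includeRight :
      R.skewRing (H : Subgroup G) →ₐ[ℤ] R.skewRingBaseChange Q (H : Subgroup G)).toRingHom

end GreenFunctor

-- The right adjoint is coinduction. For a family `V = (V_H)`, the value of `Φ V` at `K` (`coind V
-- K`) consists of families of functions `f_H : G → V_H` supported on `{y | H ≤ ʸK}`, right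
-- `K`-invariant and left `N_G(H)`-equivariant. Restriction truncates supports, induction sums over
-- cosets, and conjugation is right translation. The unit sends `m` to `y ↦ [res_H c_y m]` in the
-- Brauer quotient at `H`, and the counit evaluates at `y = 1`. The unit commutes with induction
-- because, modulo elements induced from proper subgroups of `H`, the Mackey formula becomes a plain
-- coset sum (`map_pull_ind`); the same formula for `R` makes `Φ V` an `R`-module. None of this
-- divides by `|G|`.
--
-- Suppose now that all values are `Q`-modules. A class in the kernel of the counit is represented
-- by an `f` vanishing at `1` in its `H`-component. By equivariance, and since `T` meets each
-- conjugacy class once, `f` vanishes on the top stratum `{y | ʸK = H'}` (with `K = H`) for every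
-- `H'` in `T`, and then it is an explicit sum of elements induced from proper subgroups
-- (`coind.mem_inducedSubgroup`); this needs `f` to be divisible by `|K|`. Surjectivity is extension
-- by zero from `N_G(H)`.
--
-- The unit is bijective at `K` by induction on `K`. For surjectivity, match the value on the top
-- stratum; the remainder is induced from proper subgroups, where the unit is already onto. For
-- injectivity, an element of the kernel is a sum of elements induced from proper subgroups and
-- restricts to zero on all of them. The operator `∑_{L ≤ K} μ(L,K) |L| ind_L res_L` kills the
-- former kind of element and is multiplication by `|K|` on the latter, so the element is killed by
-- `|K|` (`MackeyStructure.card_smul_eq_zero`).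
--
-- Finally, additive maps between `Q`-modules are `Q`-linear, so having a `Q`-structure is a
-- property. Hence both restriction functors are fully faithful, their essential images contain all
-- objects with `Q`-module values, and `Br` and `Φ` preserve such objects. An adjunction whose unit
-- and counit are invertible there restricts to an equivalence.

universe v'

/-! ### Sums over left cosets. -/

section CosetSum

variable {G : Type u} [Group G]

theorem quotient_subgroupOf_eq_iff {K L : Subgroup G} (a b : K) :
    (QuotientGroup.mk a : K ⧸ L.subgroupOf K) = QuotientGroup.mk b ↔ (a : G)⁻¹ * b ∈ L :=
  QuotientGroup.eq.trans Subgroup.mem_subgroupOf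

theorem existsUnique_out {K L : Subgroup G} {k : G} (hk : k ∈ K) :
    ∃! q : K ⧸ L.subgroupOf K, ((q.out : K) : G)⁻¹ * k ∈ L := by
  refine ⟨QuotientGroup.mk ⟨k, hk⟩, ?_, fun q hq => ?_⟩
  · exact (quotient_subgroupOf_eq_iff _ ⟨k, hk⟩).1 (QuotientGroup.out_eq' _)
  · rw [← QuotientGroup.out_eq' q]
    exact (quotient_subgroupOf_eq_iff _ ⟨k, hk⟩).2 hq

variable [Finite G] {A : Type*} [AddCommGroup A]

/-- The sum of `ψ` over representatives of the cosets `gL` with `g ∈ K`. -/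
noncomputable def cosetSum (K L : Subgroup G) (ψ : G → A) : A :=
  letI := Fintype.ofFinite (K ⧸ L.subgroupOf K)
  ∑ q : K ⧸ L.subgroupOf K, ψ (q.out : K)

/-- Independence of the chosen representatives: every reindexing of a coset sum below exhibits
another transversal and applies this. -/
theorem cosetSum_eq_sum {K L : Subgroup G} {ψ : G → A} (hψ : ∀ g, ∀ l ∈ L, ψ (g * l) = ψ g)
    {ι : Type*} [Fintype ι] (φ : ι → G) (hφ : ∀ i, φ i ∈ K)
    (h : ∀ k ∈ K, ∃! i, (φ i)⁻¹ * k ∈ L) : cosetSum K L ψ = ∑ i, ψ (φ i) := by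
  let := Fintype.ofFinite (K ⧸ L.subgroupOf K)
  symm
  refine Fintype.sum_bijective (fun i => (QuotientGroup.mk ⟨φ i, hφ i⟩ : K ⧸ L.subgroupOf K))
    ⟨fun i j hij => ?_, fun q => ?_⟩ _ _ fun i => ?_
  · have h1 : (φ i)⁻¹ * φ j ∈ L := (quotient_subgroupOf_eq_iff _ _).1 hij
    exact (h (φ j) (hφ j)).unique h1 (by simp)
  · obtain ⟨k, rfl⟩ := QuotientGroup.mk_surjective q
    obtain ⟨i, hi, -⟩ := h k k.2
    exact ⟨i, (quotient_subgroupOf_eq_iff _ _).2 hi⟩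
  · obtain ⟨l, hl⟩ := QuotientGroup.mk_out_eq_mul (L.subgroupOf K) ⟨φ i, hφ i⟩
    rw [hl]
    exact (hψ _ _ l.2).symm

theorem cosetSum_congr {K L : Subgroup G} {ψ ψ' : G → A} (h : ∀ g ∈ K, ψ g = ψ' g) :
    cosetSum K L ψ = cosetSum K L ψ' :=
  Finset.sum_congr rfl fun q _ => h _ q.out.2

theorem cosetSum_add (K L : Subgroup G) (ψ ψ' : G → A) :
    cosetSum K L (fun g => ψ g + ψ' g) = cosetSum K L ψ + cosetSum K L ψ' :=
  Finset.sum_add_distrib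

theorem cosetSum_zero (K L : Subgroup G) : cosetSum K L (fun _ => (0 : A)) = 0 :=
  Finset.sum_const_zero

theorem map_cosetSum {B : Type*} [AddCommGroup B] (f : A →+ B) (K L : Subgroup G) (ψ : G → A) :
    f (cosetSum K L ψ) = cosetSum K L fun g => f (ψ g) :=
  map_sum f _ _

theorem cosetSum_const (K L : Subgroup G) (a : A) :
    cosetSum K L (fun _ => a) = L.relIndex K • a := by
  let := Fintype.ofFinite (K ⧸ L.subgroupOf K)
  rw [Subgroup.relIndex, Subgroup.index, Nat.card_eq_fintype_card]
  exact Finset.sum_const a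

theorem cosetSum_self {K : Subgroup G} {ψ : G → A} (hψ : ∀ g, ∀ l ∈ K, ψ (g * l) = ψ g) :
    cosetSum K K ψ = ψ 1 := by
  rw [cosetSum_eq_sum hψ (fun _ : Unit => 1) (fun _ => one_mem K)
    (fun k hk => ⟨(), by simpa using hk, fun _ _ => rfl⟩)]
  simp

theorem cosetSum_translate {K L : Subgroup G} {ψ : G → A}
    (hψ : ∀ g, ∀ l ∈ L, ψ (g * l) = ψ g) {k : G} (hk : k ∈ K) :
    cosetSum K L (fun g => ψ (k * g)) = cosetSum K L ψ := by
  let := Fintype.ofFinite (K ⧸ L.subgroupOf K)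
  rw [cosetSum_eq_sum hψ (fun q : K ⧸ L.subgroupOf K => k * (q.out : K))
    (fun q => mul_mem hk q.out.2)]
  · rfl
  · intro g hg
    obtain ⟨q, h1, h2⟩ := existsUnique_out (L := L) (mul_mem (inv_mem hk) hg)
    exact ⟨q, by simpa [mul_assoc] using h1, fun q' h' => h2 q' (by simpa [mul_assoc] using h')⟩

theorem cosetSum_conj {K L K' L' : Subgroup G} (y : G) (hK : MulAut.conj y • K = K')
    (hL : MulAut.conj y • L = L') {ψ : G → A} (hψ : ∀ g, ∀ l ∈ L, ψ (g * l) = ψ g) :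
    cosetSum K' L' (fun g => ψ (g * y)) = cosetSum K L fun g => ψ (y * g) := by
  subst hK hL
  let := Fintype.ofFinite (K ⧸ L.subgroupOf K)
  rw [cosetSum_eq_sum (ψ := fun g => ψ (g * y)) ?_
    (fun q : K ⧸ L.subgroupOf K => y * (q.out : K) * y⁻¹) ?_ ?_]
  · refine Finset.sum_congr rfl fun q _ => ?_
    simp
  · intro g l hl
    rw [Subgroup.mem_pointwise_smul_iff_inv_smul_mem, ← map_inv] at hl
    simp only [MulAut.smul_def, MulAut.conj_apply, inv_inv] at hl
    rw [← hψ (g * y) _ hl]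
    group
  · intro q
    rw [Subgroup.mem_pointwise_smul_iff_inv_smul_mem, ← map_inv]
    simp [MulAut.smul_def, mul_assoc]
  · intro k hk
    rw [Subgroup.mem_pointwise_smul_iff_inv_smul_mem, ← map_inv] at hk
    simp only [MulAut.smul_def, MulAut.conj_apply, inv_inv] at hk
    have key : ∀ q : K ⧸ L.subgroupOf K, ((y * (q.out : K) * y⁻¹)⁻¹ * k ∈ MulAut.conj y • L ↔
        ((q.out : K) : G)⁻¹ * (y⁻¹ * k * y) ∈ L) := fun q => by
      rw [Subgroup.mem_pointwise_smul_iff_inv_smul_mem, ← map_inv]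
      simp [MulAut.smul_def, mul_assoc]
    simp only [key]
    exact existsUnique_out hk

theorem cosetSum_trans {J L K : Subgroup G} (hJL : J ≤ L) (hLK : L ≤ K) {ψ : G → A}
    (hψ : ∀ g, ∀ l ∈ J, ψ (g * l) = ψ g) :
    cosetSum K L (fun g => cosetSum L J fun l => ψ (g * l)) = cosetSum K J ψ := by
  let := Fintype.ofFinite (K ⧸ L.subgroupOf K)
  let := Fintype.ofFinite (L ⧸ J.subgroupOf L)
  rw [cosetSum_eq_sum hψ (fun q : (K ⧸ L.subgroupOf K) × (L ⧸ J.subgroupOf L) =>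
    ((q.1.out : K) : G) * (q.2.out : L)) (fun q => mul_mem q.1.out.2 (hLK q.2.out.2))]
  · rw [Fintype.sum_prod_type]
    rfl
  · intro k hk
    obtain ⟨q, h1, h2⟩ := existsUnique_out (L := L) hk
    obtain ⟨p, h3, h4⟩ := existsUnique_out (L := J) h1
    refine ⟨(q, p), by simpa [mul_assoc] using h3, fun ⟨q', p'⟩ h => ?_⟩
    have h5 : ((p'.out : L) : G)⁻¹ * (((q'.out : K) : G)⁻¹ * k) ∈ J := by
      simpa [mul_assoc] using h
    have h6 : ((q'.out : K) : G)⁻¹ * k ∈ L := by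
      simpa using mul_mem p'.out.2 (hJL h5)
    obtain rfl := h2 q' h6
    rw [h4 p' h5]

/-- The cosets of `J` inside a double coset `LxJ` are the `lxJ` with `l` running over `L / (L ∩
ˣJ)`. This puts coset sums in the shape of the right-hand side of the Mackey formula. -/
theorem cosetSum_doubleCoset {J L K : Subgroup G} (hL : L ≤ K) {ψ : G → A}
    (hψ : ∀ g, ∀ l ∈ J, ψ (g * l) = ψ g)
    [Fintype (DoubleCoset.Quotient (L.subgroupOf K : Set K) (J.subgroupOf K : Set K))] :
    cosetSum K J ψ =
      ∑ x : DoubleCoset.Quotient (L.subgroupOf K : Set K) (J.subgroupOf K : Set K),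
        cosetSum L (L ⊓ MulAut.conj ((Quotient.out x : K) : G) • J)
          fun l => ψ (l * (Quotient.out x : K)) := by
  let : ∀ x : DoubleCoset.Quotient (L.subgroupOf K : Set K) (J.subgroupOf K : Set K),
    Fintype (L ⧸ (L ⊓ MulAut.conj ((Quotient.out x : K) : G) • J).subgroupOf L) :=
      fun x => Fintype.ofFinite _
  have mem_conj : ∀ x g : G, g ∈ MulAut.conj x • J ↔ x⁻¹ * g * x ∈ J := fun x g => by
    rw [Subgroup.mem_pointwise_smul_iff_inv_smul_mem, ← map_inv]
    simp [MulAut.smul_def]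
  rw [cosetSum_eq_sum hψ
    (fun p : Σ x : DoubleCoset.Quotient (L.subgroupOf K : Set K) (J.subgroupOf K : Set K),
      L ⧸ (L ⊓ MulAut.conj ((Quotient.out x : K) : G) • J).subgroupOf L =>
    ((p.2.out : L) : G) * (Quotient.out p.1 : K))
    (fun p => mul_mem (hL p.2.out.2) (Quotient.out p.1).2)]
  · rw [Fintype.sum_sigma]
    rfl
  · intro k hk
    obtain ⟨l, hl, j, hj, hlj⟩ := (DoubleCoset.eq (L.subgroupOf K) (J.subgroupOf K) _ _).1
      (DoubleCoset.out_eq' _ _ (DoubleCoset.mk (L.subgroupOf K) (J.subgroupOf K) ⟨k, hk⟩))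
    generalize hX : DoubleCoset.mk (L.subgroupOf K) (J.subgroupOf K) ⟨k, hk⟩ = X at hlj
    obtain ⟨q, h1, h2⟩ := existsUnique_out
      (L := L ⊓ MulAut.conj ((Quotient.out X : K) : G) • J) (K := L) (k := l) hl
    have hk' : k = l * (Quotient.out X : K) * j := congrArg Subtype.val hlj
    have hj' : (j : G) ∈ J := hj
    -- Since `k = l x j`, lying in the coset `pxJ` only depends on `l`, and says that `p` and `l`
    -- agree modulo `L ∩ ˣJ`.
    have key : ∀ p : L ⧸ (L ⊓ MulAut.conj ((Quotient.out X : K) : G) • J).subgroupOf L,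
        (((p.out : L) : G) * (Quotient.out X : K))⁻¹ * k ∈ J ↔
        ((p.out : L) : G)⁻¹ * l ∈ L ⊓ MulAut.conj ((Quotient.out X : K) : G) • J := fun p => by
      have h3 : ((p.out : L) : G)⁻¹ * l ∈ L := mul_mem (inv_mem p.out.2) hl
      rw [Subgroup.mem_inf, mem_conj, and_iff_right h3, hk', ← Subgroup.mul_mem_cancel_right J hj']
      simp only [mul_inv_rev, mul_assoc]
      rw [← mul_assoc, ← mul_assoc, ← mul_assoc, ← mul_assoc, ← mul_assoc,
        Subgroup.mul_mem_cancel_right J hj', Subgroup.mul_mem_cancel_right J hj']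
      simp only [mul_assoc]
    refine ⟨⟨X, q⟩, (key q).2 h1, ?_⟩
    rintro ⟨Y, p⟩ hp
    obtain rfl : Y = X := by
      rw [← hX, ← DoubleCoset.out_eq' _ _ Y, DoubleCoset.eq]
      refine ⟨⟨(p.out : L), hL p.out.2⟩, p.out.2,
        ⟨_, mul_mem (inv_mem (mul_mem (hL p.out.2) (Quotient.out Y).2)) hk⟩, hp, ?_⟩
      ext
      simp [mul_assoc]
    rw [h2 p ((key p).1 hp)]

end CosetSum

/-! ### Möbius cancellation in a finite lattice. -/

section Mobius

/-- A finite lattice has an integral weight that cancels along the fibres of `x ↦ x ⊓ a` for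
`a < ⊤`. -/
theorem exists_weight_sum_inf_eq_zero (α : Type*) [Lattice α] [OrderTop α] [Finite α] :
    ∃ μ : α → ℤ, μ ⊤ = 1 ∧ ∀ [Fintype α] {B : Type v} [AddCommGroup B] (a : α), a ≠ ⊤ →
      ∀ g : α → B, ∑ x, μ x • g (x ⊓ a) = 0 := by
  classical
  let := Fintype.ofFinite α
  let : LocallyFiniteOrder α := Fintype.toLocallyFiniteOrder
  have hsum : ∀ b : α, ∑ x with b ≤ x, IncidenceAlgebra.mu ℤ x ⊤ = if b = ⊤ then 1 else 0 := by
    intro b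
    rw [← IncidenceAlgebra.sum_Icc_mu_left]
    refine Finset.sum_congr ?_ fun _ _ => rfl
    ext x
    simp
  refine ⟨fun x => IncidenceAlgebra.mu ℤ x ⊤, by simp, fun {inst} {B} _ a ha g => ?_⟩
  obtain rfl : inst = Fintype.ofFinite α := Subsingleton.elim _ _
  -- Weisner's theorem, by downward induction on `z`: for `z ≤ a` the sum of `μ(x, ⊤)` over `x ≥ z`
  -- vanishes because `z ≠ ⊤`; splitting it by the value of `x ⊓ a`, the parts with value above `z`
  -- vanish by induction.
  have hF : ∀ z : α, ∑ x with x ⊓ a = z, IncidenceAlgebra.mu ℤ x ⊤ = 0 := by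
    intro z
    induction z using WellFoundedGT.induction with
    | ind z ih =>
      by_cases hz : z ≤ a
      · have h1 : ∑ x with z ≤ x, IncidenceAlgebra.mu ℤ x ⊤ =
            ∑ z', ∑ x with z ≤ x ∧ x ⊓ a = z', IncidenceAlgebra.mu ℤ x ⊤ := by
          rw [← Finset.sum_fiberwise _ (fun x => x ⊓ a)]
          simp only [Finset.filter_filter]
        rw [hsum, if_neg (fun h : z = ⊤ => ha (top_le_iff.1 (h ▸ hz))),
          Finset.sum_eq_single z] at h1
        · rw [h1]
          refine Finset.sum_congr ?_ fun _ _ => rfl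
          ext x
          simp only [Finset.mem_filter, Finset.mem_univ, true_and]
          exact ⟨fun h => ⟨h ▸ inf_le_left, h⟩, And.right⟩
        · intro z' _ hne
          by_cases hz' : z ≤ z'
          · rw [← ih z' (lt_of_le_of_ne hz' hne.symm)]
            refine Finset.sum_congr ?_ fun _ _ => rfl
            ext x
            simp only [Finset.mem_filter, Finset.mem_univ, true_and]
            exact ⟨And.right, fun h => ⟨hz'.trans (h ▸ inf_le_left), h⟩⟩
          · refine Finset.sum_eq_zero fun x hx => absurd ?_ hz'
            simp only [Finset.mem_filter, Finset.mem_univ, true_and] at hx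
            rw [← hx.2]
            exact le_inf hx.1 hz
        · simp
      · refine Finset.sum_eq_zero fun x hx => absurd ?_ hz
        simp only [Finset.mem_filter, Finset.mem_univ, true_and] at hx
        rw [← hx]
        exact inf_le_right
  rw [← Finset.sum_fiberwise _ (fun x => x ⊓ a)]
  refine Finset.sum_eq_zero fun z _ => ?_
  rw [Finset.sum_congr (g := fun x => IncidenceAlgebra.mu ℤ x ⊤ • g z) rfl, ← Finset.sum_smul,
    hF, zero_smul]
  intro x hx
  rw [(Finset.mem_filter.1 hx).2]

end Mobius

/-! ### Conjugate subgroups and restriction after conjugation. -/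

section Conj

variable {G : Type u} [Group G]

theorem conj_smul_eq_of_mem {K : Subgroup G} {k : G} (hk : k ∈ K) : MulAut.conj k • K = K :=
  conj_smul_eq_of_mem_normalizer ⟨k, Subgroup.le_normalizer hk⟩

theorem conj_mul_smul (y g : G) (K : Subgroup G) :
    MulAut.conj (y * g) • K = MulAut.conj y • MulAut.conj g • K := by
  rw [map_mul, mul_smul]

theorem conj_mul_smul_of_mem (y : G) {K : Subgroup G} {k : G} (hk : k ∈ K) :
    MulAut.conj (y * k) • K = MulAut.conj y • K := by
  rw [conj_mul_smul, conj_smul_eq_of_mem hk]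

theorem le_conj_normalizer_mul_smul_iff {H K : Subgroup G} (n : Subgroup.normalizer (H : Set G))
    (y : G) : H ≤ MulAut.conj ((n : G) * y) • K ↔ H ≤ MulAut.conj y • K := by
  rw [conj_mul_smul]
  nth_rw 1 [← conj_smul_eq_of_mem_normalizer n]
  exact Subgroup.pointwise_smul_le_pointwise_smul_iff

end Conj

namespace MackeyStructure

variable {G : Type u} [Group G] {M : Subgroup G → Type v} [∀ H, AddCommGroup (M H)]
  (S : MackeyStructure G M)

open Classical in
/-- Conjugation by `y` followed by restriction to `H`, and zero if `H` is not contained in `ʸK`. -/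
noncomputable def pull (H : Subgroup G) (y : G) (K : Subgroup G) : M K →+ M H :=
  if h : H ≤ MulAut.conj y • K then (S.res h).comp (S.conj y rfl) else 0

theorem pull_of_le {H K K' : Subgroup G} {y : G} (hK : MulAut.conj y • K = K') (h : H ≤ K')
    (m : M K) : S.pull H y K m = S.res h (S.conj y hK m) := by
  subst hK
  rw [pull, dif_pos h]
  rfl

theorem pull_of_not_le {H K : Subgroup G} {y : G} (h : ¬ H ≤ MulAut.conj y • K)
    (m : M K) : S.pull H y K m = 0 := by
  rw [pull, dif_neg h]
  rfl

theorem pull_one_self (K : Subgroup G) (m : M K) : S.pull K 1 K m = m := by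
  have h : MulAut.conj (1 : G) • K = K := by simp
  rw [S.pull_of_le h le_rfl, S.res_self, S.conj_of_mem 1 (one_mem K)]

theorem pull_res {H L K : Subgroup G} {y : G} (hLK : L ≤ K) (h : H ≤ MulAut.conj y • L)
    (m : M K) : S.pull H y L (S.res hLK m) = S.pull H y K m := by
  have h1 : MulAut.conj y • L ≤ MulAut.conj y • K :=
    Subgroup.pointwise_smul_le_pointwise_smul_iff.2 hLK
  rw [S.pull_of_le rfl h, S.pull_of_le rfl (h.trans h1), S.conj_res y hLK h1 rfl rfl, S.res_res]

theorem pull_conj (H : Subgroup G) (y g : G) {K K' : Subgroup G} (hK : MulAut.conj g • K = K')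
    (m : M K) : S.pull H y K' (S.conj g hK m) = S.pull H (y * g) K m := by
  have h1 : MulAut.conj (y * g) • K = MulAut.conj y • K' := by rw [conj_mul_smul, hK]
  by_cases h : H ≤ MulAut.conj y • K'
  · rw [S.pull_of_le rfl h, S.pull_of_le h1 h, S.conj_conj]
  · rw [S.pull_of_not_le h, S.pull_of_not_le (h1 ▸ h)]

theorem pull_mul_mem (H : Subgroup G) (y : G) {K : Subgroup G} {k : G} (hk : k ∈ K) (m : M K) :
    S.pull H (y * k) K m = S.pull H y K m := by
  rw [← S.pull_conj H y k (conj_smul_eq_of_mem hk), S.conj_of_mem k hk]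

theorem pull_normalizer_mul {H : Subgroup G} (n : Subgroup.normalizer (H : Set G)) (y : G)
    (K : Subgroup G) (m : M K) : S.pull H (n * y) K m =
      S.conj n (conj_smul_eq_of_mem_normalizer n) (S.pull H y K m) := by
  by_cases h : H ≤ MulAut.conj y • K
  · have h' := (le_conj_normalizer_mul_smul_iff n y).2 h
    rw [S.pull_of_le rfl h, S.conj_res n h (conj_mul_smul (n : G) y K ▸ h') _ rfl,
      S.conj_conj y n rfl rfl (conj_mul_smul (n : G) y K), S.pull_of_le]
  · have h' := (le_conj_normalizer_mul_smul_iff n y).not.2 h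
    rw [S.pull_of_not_le h, S.pull_of_not_le h', map_zero]

theorem pull_mem_mul {H : Subgroup G} {h : G} (hh : h ∈ H) (y : G)
    (K : Subgroup G) (m : M K) : S.pull H (h * y) K m = S.pull H y K m := by
  rw [S.pull_normalizer_mul ⟨h, Subgroup.le_normalizer hh⟩, S.conj_of_mem h hh]

/-- Two inequalities in place of an equation allow this to be used for `Z = H ⊓ ˣL` without
rewriting inside dependent types. -/
theorem ind_res_of_le {Z H X : Subgroup G} (h : Z ≤ H) (h' : H ≤ Z) (hX : Z ≤ X) (m : M X) :
    S.ind h (S.res hX m) = S.res (h'.trans hX) m := by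
  obtain rfl := le_antisymm h h'
  exact S.ind_self _ _

section Finite

variable [Finite G]

/-- The Mackey formula modulo elements induced from proper subgroups. -/
theorem map_pull_ind {A : Type*} [AddCommGroup A] {H : Subgroup G} (π : M H →+ A)
    (hπ : ∀ x ∈ S.inducedSubgroup H, π x = 0) (y : G) {L K : Subgroup G} (hLK : L ≤ K) (m : M L) :
    π (S.pull H y K (S.ind hLK m)) = cosetSum K L fun g => π (S.pull H (y * g) L m) := by
  have hLK' : MulAut.conj y • L ≤ MulAut.conj y • K :=
    Subgroup.pointwise_smul_le_pointwise_smul_iff.2 hLK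
  by_cases h : H ≤ MulAut.conj y • K
  · have : Finite (DoubleCoset.Quotient
          (H.subgroupOf (MulAut.conj y • K) : Set (MulAut.conj y • K : Subgroup G))
          ((MulAut.conj y • L).subgroupOf (MulAut.conj y • K) :
          Set (MulAut.conj y • K : Subgroup G))) := Quotient.finite _
    let := Fintype.ofFinite (DoubleCoset.Quotient
          (H.subgroupOf (MulAut.conj y • K) : Set (MulAut.conj y • K : Subgroup G))
          ((MulAut.conj y • L).subgroupOf (MulAut.conj y • K) :
          Set (MulAut.conj y • K : Subgroup G)))
    have hψ : ∀ g, ∀ l ∈ L, π (S.pull H (g * l) L m) = π (S.pull H g L m) :=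
      fun g l hl => by rw [S.pull_mul_mem H g hl]
    have hψ' : ∀ g, ∀ l ∈ MulAut.conj y • L,
        π (S.pull H (g * l * y) L m) = π (S.pull H (g * y) L m) := by
      intro g l hl
      rw [← S.pull_conj H (g * l) y rfl, ← S.pull_conj H g y rfl, S.pull_mul_mem H g hl]
    -- The sum over `K / L` is moved to `ʸK / ʸL`, where it can be compared with the Mackey formula
    -- for `H` and `ʸL` inside `ʸK`.
    rw [← cosetSum_conj (ψ := fun g => π (S.pull H g L m)) y rfl rfl hψ,
      cosetSum_doubleCoset (ψ := fun g => π (S.pull H (g * y) L m)) h hψ', S.pull_of_le rfl h,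
      S.conj_ind y hLK hLK' rfl rfl, S.res_ind h hLK', finsum_eq_sum_of_fintype, map_sum]
    refine Finset.sum_congr rfl fun x _ => ?_
    generalize ((Quotient.out x : (MulAut.conj y • K : Subgroup G)) : G) = x
    rw [cosetSum_congr (ψ' := fun _ => π (S.pull H (x * y) L m)), cosetSum_const]
    -- If `H ≤ ˣʸL`, the double coset is a single coset and the Mackey term is a plain restriction.
    -- Otherwise the term is induced from a proper subgroup of `H`, so `π` kills it.
    · by_cases hx : H ≤ MulAut.conj x • MulAut.conj y • L
      · rw [Subgroup.relIndex_eq_one.2 (le_inf le_rfl hx), one_smul,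
          S.ind_res_of_le _ (le_inf le_rfl hx), S.conj_conj y x rfl rfl (conj_mul_smul x y L),
          S.pull_of_le (conj_mul_smul x y L) hx]
      · rw [S.pull_of_not_le (by rwa [conj_mul_smul]), map_zero, smul_zero]
        exact hπ _ (S.ind_mem_inducedSubgroup (inf_lt_left.2 hx) _)
    · intro l hl
      rw [mul_assoc, S.pull_mem_mul hl]
  · rw [S.pull_of_not_le h, map_zero, ← cosetSum_zero K L]
    refine cosetSum_congr fun g hg => ?_
    rw [S.pull_of_not_le, map_zero]
    intro h'
    refine h (h'.trans ?_)
    rw [conj_mul_smul]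
    refine Subgroup.pointwise_smul_le_pointwise_smul_iff.2 ?_
    rw [← conj_smul_eq_of_mem hg]
    exact Subgroup.pointwise_smul_le_pointwise_smul_iff.2 hLK

/-- The double coset of `x` contains `[L : L ∩ ˣJ]` cosets of `J`, and `|L| = |L ∩ ˣJ| [L : L ∩
ˣJ]`. Multiplying by `|L|` thus makes the index set `K / J` independent of `L`, so that such
formulas can be summed over `L`. -/
theorem card_smul_res_ind {L J K : Subgroup G} (hL : L ≤ K) (hJ : J ≤ K) (m : M J) :
    Nat.card L • S.res hL (S.ind hJ m) = cosetSum K J fun y =>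
      Nat.card (L ⊓ MulAut.conj y • J : Subgroup G) •
        S.ind inf_le_left (S.pull (L ⊓ MulAut.conj y • J) y J m) := by
  have : Finite (DoubleCoset.Quotient (L.subgroupOf K : Set K) (J.subgroupOf K : Set K)) :=
    Quotient.finite _
  let := Fintype.ofFinite (DoubleCoset.Quotient (L.subgroupOf K : Set K) (J.subgroupOf K : Set K))
  have hcard : ∀ Z ≤ L, Nat.card Z * Z.relIndex L = Nat.card L := fun Z hZ => by
    rw [← Subgroup.relIndex_bot_left, Subgroup.relIndex_mul_relIndex _ _ _ bot_le hZ,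
      Subgroup.relIndex_bot_left]
  rw [cosetSum_doubleCoset hL, S.res_ind hL hJ, finsum_eq_sum_of_fintype, Finset.smul_sum]
  · refine Finset.sum_congr rfl fun x _ => ?_
    generalize ((Quotient.out x : K) : G) = x
    rw [cosetSum_congr (ψ' := fun _ => Nat.card (L ⊓ MulAut.conj x • J : Subgroup G) •
        S.ind inf_le_left (S.pull (L ⊓ MulAut.conj x • J) x J m)), cosetSum_const, smul_smul,
      mul_comm, hcard (L ⊓ MulAut.conj x • J) inf_le_left, S.pull_of_le rfl inf_le_right]
    intro l hl
    have hL' : MulAut.conj l • (L ⊓ MulAut.conj x • J) = L ⊓ MulAut.conj (l * x) • J := by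
      rw [Subgroup.smul_inf, conj_mul_smul, conj_smul_eq_of_mem hl]
    have hc : Nat.card (L ⊓ MulAut.conj (l * x) • J : Subgroup G) =
        Nat.card (L ⊓ MulAut.conj x • J : Subgroup G) := by
      rw [← hL']
      exact Nat.card_congr
        (Subgroup.equivSMul (MulAut.conj l) (L ⊓ MulAut.conj x • J)).symm.toEquiv
    rw [hc]
    congr 1
    -- Conjugation by `l ∈ L` is the identity on `M L`, and it carries the summand at `x` to the
    -- summand at `l * x`.
    rw [S.pull_of_le (y := l * x) (conj_mul_smul l x J)
        (inf_le_right.trans_eq (conj_mul_smul l x J)),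
      S.pull_of_le (y := x) rfl inf_le_right,
      ← S.conj_of_mem l hl (conj_smul_eq_of_mem hl)
        (S.ind (inf_le_left : L ⊓ MulAut.conj x • J ≤ L) _),
      S.conj_ind l inf_le_left inf_le_left hL',
      S.conj_res l inf_le_right (inf_le_right.trans_eq (conj_mul_smul l x J)) hL' rfl,
      S.conj_conj x l rfl rfl (conj_mul_smul l x J)]
  · intro g l hl
    have h1 : ∀ X Y : Subgroup G, X = Y → Nat.card (L ⊓ X : Subgroup G) •
        S.ind inf_le_left (S.pull (L ⊓ X) g J m) = Nat.card (L ⊓ Y : Subgroup G) •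
        S.ind inf_le_left (S.pull (L ⊓ Y) g J m) := by
      rintro _ _ rfl
      rfl
    simp only [S.pull_mul_mem _ g hl]
    exact h1 _ _ (conj_mul_smul_of_mem g hl)

/-- If `m` is a sum of elements induced from proper subgroups and restricts to zero on proper
subgroups, then `m` is annihilated by the order of the group. -/
theorem card_smul_eq_zero {K : Subgroup G} {m : M K} (hm : m ∈ S.inducedSubgroup K)
    (hres : ∀ (L : Subgroup G) (h : L < K), S.res h.le m = 0) : Nat.card K • m = 0 := by
  classical
  let := Fintype.ofFinite (Set.Iic K)
  obtain ⟨μ, hμ, hsum⟩ := exists_weight_sum_inf_eq_zero (Set.Iic K)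
  -- The operator `∑ μ(L) |L| ind_L res_L`, modelled on Gluck's formula for the idempotents of the
  -- Burnside ring. It kills all elements induced from proper subgroups, and only its term `L = K`
  -- survives on `m`.
  let E : M K →+ M K := ∑ L : Set.Iic K, μ L • (Nat.card (L : Subgroup G)) •
    (S.ind (Set.mem_Iic.1 L.2)).comp (S.res (Set.mem_Iic.1 L.2))
  have hE : ∀ x, E x = ∑ L : Set.Iic K, μ L • (Nat.card (L : Subgroup G)) •
      S.ind (Set.mem_Iic.1 L.2) (S.res (Set.mem_Iic.1 L.2) x) := fun x => by
    rw [AddMonoidHom.finsetSum_apply]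
    rfl
  have h1 : S.inducedSubgroup K ≤ E.ker := by
    refine S.inducedSubgroup_le fun J hJ n => ?_
    have hterm : ∀ L : Set.Iic K, μ L • (Nat.card (L : Subgroup G)) •
        S.ind (Set.mem_Iic.1 L.2) (S.res (Set.mem_Iic.1 L.2) (S.ind hJ.le n)) =
        cosetSum K J fun y => μ L • Nat.card (L ⊓ MulAut.conj y • J : Subgroup G) •
          S.ind (inf_le_left.trans (Set.mem_Iic.1 L.2))
            (S.pull (L ⊓ MulAut.conj y • J) y J n) := fun L => by
      rw [← map_nsmul, S.card_smul_res_ind _ hJ.le, map_cosetSum]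
      simp only [map_nsmul, S.ind_ind]
      exact Finset.smul_sum
    rw [AddMonoidHom.mem_ker, hE, Finset.sum_congr rfl fun L _ => hterm L]
    unfold cosetSum
    rw [Finset.sum_comm]
    refine Finset.sum_eq_zero fun q _ => ?_
    have hy := (q.out : K).2
    generalize ((q.out : K) : G) = y at hy
    have hJ' : MulAut.conj y • J < K := by
      refine lt_of_le_of_ne ?_ fun h => hJ.ne ?_
      · rw [← conj_smul_eq_of_mem hy]
        exact Subgroup.pointwise_smul_le_pointwise_smul_iff.2 hJ.le
      · exact smul_left_cancel (MulAut.conj y) (h.trans (conj_smul_eq_of_mem hy).symm)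
    -- For fixed `y` the summand depends on `L` only through `L ∩ ʸJ`, and `ʸJ < K`, so the weights
    -- cancel.
    have h2 := hsum (⟨MulAut.conj y • J, hJ'.le⟩ : Set.Iic K)
      (fun h => hJ'.ne (congrArg Subtype.val h))
      (fun Z => Nat.card (Z : Subgroup G) • S.ind (Set.mem_Iic.1 Z.2) (S.pull Z y J n))
    exact h2
  have h2 := h1 hm
  rw [AddMonoidHom.mem_ker, hE, Finset.sum_eq_single (⊤ : Set.Iic K)] at h2
  · rw [hμ, one_smul] at h2
    have h3 : S.ind (⊤ : Set.Iic K).2 (S.res (⊤ : Set.Iic K).2 m) = m :=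
      (S.ind_self _ _).trans (S.res_self _ _)
    rwa [h3] at h2
  · intro L _ hL
    have h3 : (L : Subgroup G) < K := lt_of_le_of_ne L.2 fun h => hL (Subtype.ext h)
    rw [hres L h3, map_zero, smul_zero, smul_zero]
  · simp

end Finite

end MackeyStructure

/-! ### Transport of structure, used to change universes. -/

section Transport

variable {G : Type u} [Group G]

/-- Transport of a Mackey functor along isomorphisms of abelian groups. -/
def MackeyStructure.transport {M : Subgroup G → Type v'} [∀ H, AddCommGroup (M H)]
    (S : MackeyStructure G M) {N : Subgroup G → Type v} [∀ H, AddCommGroup (N H)]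
    (e : ∀ H, N H ≃+ M H) : MackeyStructure G N where
  res {K H} h := (e K).symm.toAddMonoidHom.comp ((S.res h).comp (e H).toAddMonoidHom)
  ind {K H} h := (e H).symm.toAddMonoidHom.comp ((S.ind h).comp (e K).toAddMonoidHom)
  conj g {H K} h := (e K).symm.toAddMonoidHom.comp ((S.conj g h).comp (e H).toAddMonoidHom)
  res_self h m := by simp [S.res_self]
  ind_self h m := by simp [S.ind_self]
  res_res hL hK m := by simp [S.res_res]
  ind_ind hL hK m := by simp [S.ind_ind]
  conj_of_mem g hg h m := by simp [S.conj_of_mem g hg]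
  conj_conj g g' _ _ _ h h' h'' m := by simp [S.conj_conj g g' h h' h'']
  conj_res g _ _ _ _ hKH hKH' hK hH m := by simp [S.conj_res g hKH hKH' hK hH]
  conj_ind g _ _ _ _ hKH hKH' hK hH m := by simp [S.conj_ind g hKH hKH' hK hH]
  res_ind hK hL m := by
    simp only [AddMonoidHom.comp_apply, AddEquiv.toAddMonoidHom_eq_coe, AddMonoidHom.coe_coe,
      AddEquiv.apply_symm_apply, S.res_ind hK hL, AddEquiv.map_finsum]

/-- Transport of a Mackey module along linear isomorphisms. -/
def MackeyModule.transport {R : GreenFunctor.{u, w} G} (M : MackeyModule.{u, v', w} R)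
    {N : Subgroup G → Type v} [∀ H, AddCommGroup (N H)] [∀ H, Module (R.obj H) (N H)]
    (e : ∀ H, N H ≃ₗ[R.obj H] M.obj H) : MackeyModule.{u, v, w} R where
  obj := N
  str := M.str.transport fun H => (e H).toAddEquiv
  res_smul h r m := by simp [MackeyStructure.transport, M.res_smul]
  conj_smul g _ _ h r m := by simp [MackeyStructure.transport, M.conj_smul]
  ind_res_smul h r m := by simp [MackeyStructure.transport, M.ind_res_smul]
  ind_smul_res h r m := by simp [MackeyStructure.transport, M.ind_smul_res]

end Transport

/-! ### The skew group ring through `R(H)` and `N_G(H)`. -/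

namespace GreenFunctor

variable {G : Type u} [Group G] (R : GreenFunctor.{u, w} G) {H : Subgroup G}

theorem skewSingle_mul_skewSingle (s s' : R.brauerQuotient H) (y y' : WeylGroup H) :
    R.skewSingle s y * R.skewSingle s' y' = R.skewSingle (s * y • s') (y * y') :=
  SkewMonoidAlgebra.single_mul_single

variable (H) in
/-- The canonical ring homomorphism from `R(H)` to the skew group ring. -/
noncomputable def coeffHom : R.obj H →+* R.skewRing H where
  toFun r := R.skewSingle (Ideal.Quotient.mk _ r) 1
  map_one' := rfl
  map_mul' r s := by rw [skewSingle_mul_skewSingle, one_smul, map_mul, one_mul]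
  map_zero' := SkewMonoidAlgebra.single_zero _
  map_add' r s := by rw [map_add]; exact SkewMonoidAlgebra.single_add _ _ _

variable (H) in
/-- The canonical homomorphism from `N_G(H)` to the skew group ring. -/
noncomputable def normalizerHom : Subgroup.normalizer (H : Set G) →* R.skewRing H where
  toFun n := R.skewSingle 1 (QuotientGroup.mk n)
  map_one' := rfl
  map_mul' n n' := by rw [skewSingle_mul_skewSingle, smul_one, one_mul, QuotientGroup.mk_mul]

theorem skewSingle_mk (r : R.obj H) (n : Subgroup.normalizer (H : Set G)) :
    R.skewSingle (Ideal.Quotient.mk _ r) (QuotientGroup.mk n) =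
      R.coeffHom H r * R.normalizerHom H n := by
  refine Eq.trans ?_ (R.skewSingle_mul_skewSingle _ _ _ _).symm
  rw [smul_one, mul_one, one_mul]

theorem normalizerHom_mul_coeffHom (n : Subgroup.normalizer (H : Set G)) (r : R.obj H) :
    R.normalizerHom H n * R.coeffHom H r =
      R.coeffHom H (R.str.conj n (conj_smul_eq_of_mem_normalizer n) r) * R.normalizerHom H n := by
  rw [← skewSingle_mk]
  refine (R.skewSingle_mul_skewSingle _ _ _ _).trans ?_
  rw [one_mul, mul_one]
  rfl

theorem coeffHom_eq_zero {r : R.obj H} (hr : r ∈ R.str.inducedSubgroup H) :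
    R.coeffHom H r = 0 := by
  have h : Ideal.Quotient.mk (R.brauerIdeal H) r = 0 := Ideal.Quotient.eq_zero_iff_mem.2 hr
  change R.skewSingle (Ideal.Quotient.mk _ r) 1 = 0
  rw [h]
  exact SkewMonoidAlgebra.single_zero _

theorem normalizerHom_eq_one {n : Subgroup.normalizer (H : Set G)} (hn : (n : G) ∈ H) :
    R.normalizerHom H n = 1 := by
  have h : (QuotientGroup.mk n : WeylGroup H) = 1 := (QuotientGroup.eq_one_iff n).2 hn
  change R.skewSingle 1 (QuotientGroup.mk n) = 1
  rw [h]
  rfl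

theorem normalizerHom_smul_smul {X : Type*} [AddCommGroup X] [Module (R.skewRing H) X]
    (n : Subgroup.normalizer (H : Set G)) (r : R.obj H) (x : X) :
    R.normalizerHom H n • R.coeffHom H r • x =
      R.coeffHom H (R.str.conj n (conj_smul_eq_of_mem_normalizer n) r) •
        R.normalizerHom H n • x := by
  rw [smul_smul, normalizerHom_mul_coeffHom, mul_smul]

/-- An additive map that commutes with the actions of `R(H)` and `N_G(H)` is linear over the
skew group ring. -/
def skewLinearMap {X Y : Type*} [AddCommGroup X] [AddCommGroup Y] [Module (R.skewRing H) X]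
    [Module (R.skewRing H) Y] (f : X →+ Y)
    (hr : ∀ r x, f (R.coeffHom H r • x) = R.coeffHom H r • f x)
    (hn : ∀ n x, f (R.normalizerHom H n • x) = R.normalizerHom H n • f x) :
    X →ₗ[R.skewRing H] Y where
  __ := f
  map_smul' a x := by
    change f (a • x) = a • f x
    induction a using R.skewRing_induction with
    | zero => simp
    | add a b ha hb => rw [add_smul, map_add, ha, hb, add_smul]
    | single s y =>
      obtain ⟨n, rfl⟩ := QuotientGroup.mk_surjective y
      obtain ⟨r, rfl⟩ := Ideal.Quotient.mk_surjective s
      rw [skewSingle_mk, mul_smul, hr, hn, mul_smul]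

end GreenFunctor

namespace MackeyModule

variable {G : Type u} [Group G] {R : GreenFunctor.{u, w} G} (M : MackeyModule.{u, v, w} R)
  (H : Subgroup G)

/-- The projection onto the Brauer quotient. -/
def brauerMk : M.obj H →+ M.brauerQuotient H := (M.brauerSubmodule H).mkQ.toAddMonoidHom

theorem brauerMk_surjective : Function.Surjective (M.brauerMk H) :=
  Submodule.Quotient.mk_surjective _

variable {M H}

theorem brauerMk_eq_zero_iff {m : M.obj H} : M.brauerMk H m = 0 ↔ m ∈ M.str.inducedSubgroup H :=
  Submodule.Quotient.mk_eq_zero _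

theorem brauerMk_smul (r : R.obj H) (m : M.obj H) :
    M.brauerMk H (r • m) = R.coeffHom H r • M.brauerMk H m := by
  refine Eq.trans ?_ (M.skewSingle_smul H _ _ _).symm
  rw [map_one]
  rfl

theorem brauerMk_conj (n : Subgroup.normalizer (H : Set G)) (m : M.obj H) :
    M.brauerMk H (M.str.conj n (conj_smul_eq_of_mem_normalizer n) m) =
      R.normalizerHom H n • M.brauerMk H m := by
  refine Eq.trans ?_ (M.skewSingle_smul H _ _ _).symm
  rw [one_smul]
  rfl

end MackeyModule

section

variable {G : Type u} [Group G]

theorem le_conj_mul_smul_of_mem_iff {H K : Subgroup G} {y k : G} (hk : k ∈ K) :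
    H ≤ MulAut.conj (y * k) • K ↔ H ≤ MulAut.conj y • K := by
  rw [conj_mul_smul_of_mem y hk]

theorem le_conj_mul_smul_iff {H K K' : Subgroup G} {y g : G} (hK : MulAut.conj g • K = K') :
    H ≤ MulAut.conj (y * g) • K ↔ H ≤ MulAut.conj y • K' := by
  rw [conj_mul_smul, hK]

theorem le_conj_smul_mono {H L K : Subgroup G} {y : G} (hLK : L ≤ K)
    (h : H ≤ MulAut.conj y • L) : H ≤ MulAut.conj y • K :=
  h.trans (Subgroup.pointwise_smul_le_pointwise_smul_iff.2 hLK)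

end

/-! ### The coinduced Mackey module. -/

namespace GreenFunctor

variable {G : Type u} [Group G] {R : GreenFunctor.{u, w} G} {T : Set (Subgroup G)}
  (V : ∀ H : T, ModuleCat.{v} (R.skewRing (H : Subgroup G)))

/-- The value at `K` of the right adjoint of the Brauer quotient functor: families of functions
`f_H : G → V_H` supported on `{y | H ≤ ʸK}`, invariant under right translation by `K` and
equivariant for left translation by `N_G(H)`. -/
def coind (K : Subgroup G) : AddSubgroup (∀ H : T, G → V H) where
  carrier := {f | (∀ (H : T) y, ¬ (H : Subgroup G) ≤ MulAut.conj y • K → f H y = 0) ∧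
    (∀ (H : T) y, ∀ k ∈ K, f H (y * k) = f H y) ∧
    ∀ (H : T) y (n : Subgroup.normalizer ((H : Subgroup G) : Set G)),
      f H (n * y) = R.normalizerHom (H : Subgroup G) n • f H y}
  add_mem' := by
    rintro f f' ⟨h1, h2, h3⟩ ⟨h1', h2', h3'⟩
    refine ⟨fun H y h => ?_, fun H y k hk => ?_, fun H y n => ?_⟩
    · simp [h1 H y h, h1' H y h]
    · simp [h2 H y k hk, h2' H y k hk]
    · simp [h3 H y n, h3' H y n]
  zero_mem' := by simp
  neg_mem' := by
    rintro f ⟨h1, h2, h3⟩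
    refine ⟨fun H y h => ?_, fun H y k hk => ?_, fun H y n => ?_⟩
    · simp [h1 H y h]
    · simp [h2 H y k hk]
    · simp [h3 H y n]

variable {V}

namespace coind

variable {K : Subgroup G}

theorem apply_of_not_le (f : coind V K) {H : T} {y : G}
    (h : ¬ (H : Subgroup G) ≤ MulAut.conj y • K) : f.1 H y = 0 := f.2.1 H y h

theorem apply_mul_mem (f : coind V K) (H : T) (y : G) {k : G} (hk : k ∈ K) :
    f.1 H (y * k) = f.1 H y := f.2.2.1 H y k hk

theorem apply_normalizer_mul (f : coind V K) (H : T) (y : G)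
    (n : Subgroup.normalizer ((H : Subgroup G) : Set G)) :
    f.1 H (n * y) = R.normalizerHom (H : Subgroup G) n • f.1 H y := f.2.2.2 H y n

@[ext]
theorem ext {f f' : coind V K} (h : ∀ H y, f.1 H y = f'.1 H y) : f = f' :=
  Subtype.ext (funext fun H => funext fun y => h H y)

/-- Evaluation. -/
def eval (H : T) (y : G) : coind V K →+ V H where
  toFun f := f.1 H y
  map_zero' := rfl
  map_add' _ _ := rfl

open Classical in
/-- Restriction, by truncating the support. -/
noncomputable def res {L K : Subgroup G} (h : L ≤ K) : coind V K →+ coind V L where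
  toFun f := ⟨fun H y => if (H : Subgroup G) ≤ MulAut.conj y • L then f.1 H y else 0,
    fun H y h' => if_neg h',
    fun H y k hk => by simp only [le_conj_mul_smul_of_mem_iff hk, apply_mul_mem f H y (h hk)],
    fun H y n => by
      simp only [le_conj_normalizer_mul_smul_iff, apply_normalizer_mul]
      split_ifs <;> simp⟩
  map_zero' := by ext; simp
  map_add' f f' := by
    ext H y
    change (if _ then f.1 H y + f'.1 H y else 0) = (if _ then _ else _) + if _ then _ else _
    split_ifs <;> simp

theorem res_apply {L K : Subgroup G} (h : L ≤ K) (f : coind V K) {H : T} {y : G}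
    (hy : (H : Subgroup G) ≤ MulAut.conj y • L) : (res h f).1 H y = f.1 H y :=
  if_pos hy

/-- Conjugation, by right translation. -/
def conj (g : G) {K K' : Subgroup G} (h : MulAut.conj g • K = K') : coind V K →+ coind V K' where
  toFun f := ⟨fun H y => f.1 H (y * g),
    fun H y h' => apply_of_not_le f (by rwa [le_conj_mul_smul_iff h]),
    fun H y k hk => by
      subst h
      obtain ⟨k, hk, rfl⟩ := hk
      have h1 : y * (g * k * g⁻¹) * g = y * g * k := by group
      exact (congrArg (f.1 H) h1).trans (apply_mul_mem f H (y * g) hk),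
    fun H y n => by
      dsimp only
      rw [mul_assoc, apply_normalizer_mul]⟩
  map_zero' := rfl
  map_add' _ _ := rfl

/-- The action of `R(K)`. -/
noncomputable instance : SMul (R.obj K) (coind V K) where
  smul r f := ⟨fun H y => R.coeffHom (H : Subgroup G) (R.str.pull H y K r) • f.1 H y,
    fun H y h => by
      dsimp only
      rw [apply_of_not_le f h, smul_zero],
    fun H y k hk => by
      dsimp only
      rw [R.str.pull_mul_mem _ _ hk, apply_mul_mem f H y hk],
    fun H y n => by
      dsimp only
      rw [R.str.pull_normalizer_mul, apply_normalizer_mul, normalizerHom_smul_smul]⟩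

theorem smul_apply (r : R.obj K) (f : coind V K) (H : T) (y : G) :
    (r • f).1 H y = R.coeffHom (H : Subgroup G) (R.str.pull H y K r) • f.1 H y := rfl

theorem add_apply (f f' : coind V K) (H : T) (y : G) :
    (f + f').1 H y = f.1 H y + f'.1 H y := rfl

noncomputable instance : Module (R.obj K) (coind V K) where
  one_smul f := by
    ext H y
    rw [smul_apply]
    -- `pull` sends `1` to `1` only where `H ≤ ʸK`. Elsewhere it is zero, and the law holds because
    -- `f` vanishes there.
    by_cases h : (H : Subgroup G) ≤ MulAut.conj y • K
    · rw [R.str.pull_of_le rfl h, R.conj_one, R.res_one, map_one, one_smul]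
    · rw [apply_of_not_le f h, smul_zero]
  mul_smul r s f := by
    ext H y
    simp only [smul_apply]
    by_cases h : (H : Subgroup G) ≤ MulAut.conj y • K
    · simp only [R.str.pull_of_le rfl h]
      rw [R.conj_mul, R.res_mul, map_mul, mul_smul]
    · rw [apply_of_not_le f h, smul_zero, smul_zero, smul_zero]
  smul_zero r := by
    ext H y
    exact smul_zero _
  smul_add r f f' := by
    ext H y
    exact smul_add _ _ _
  add_smul r s f := by
    ext H y
    simp only [smul_apply, add_apply, map_add, add_smul]
  zero_smul f := by
    ext H y
    rw [smul_apply, map_zero, map_zero, zero_smul]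
    rfl

section Finite

variable [Finite G]

/-- Induction, by summation over cosets. -/
noncomputable def ind {L K : Subgroup G} (h : L ≤ K) : coind V L →+ coind V K where
  toFun f := ⟨fun H y => cosetSum K L fun g => f.1 H (y * g),
    fun H y h' => by
      rw [← cosetSum_zero K L]
      refine cosetSum_congr fun g hg => apply_of_not_le f fun h'' => h' ?_
      exact (le_conj_mul_smul_of_mem_iff hg).1 (le_conj_smul_mono h h''),
    fun H y k hk => by
      simp only [mul_assoc]
      exact cosetSum_translate (ψ := fun g => f.1 H (y * g))
        (fun g l hl => by rw [← mul_assoc, apply_mul_mem f H _ hl]) hk,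
    fun H y n => by
      simp only [mul_assoc, apply_normalizer_mul]
      exact (map_cosetSum (DistribSMul.toAddMonoidHom (V H) (R.normalizerHom (H : Subgroup G) n))
        K L _).symm⟩
  map_zero' := by
    ext H y
    exact cosetSum_zero (A := V H) K L
  map_add' f f' := by
    ext H y
    exact cosetSum_add (A := V H) K L (fun g => f.1 H (y * g)) fun g => f'.1 H (y * g)

theorem ind_apply {L K : Subgroup G} (h : L ≤ K) (f : coind V L) (H : T) (y : G) :
    (ind h f).1 H y = cosetSum K L fun g => f.1 H (y * g) := rfl

variable (V) in
/-- The Mackey functor `K ↦ coind V K`. -/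
noncomputable def str : MackeyStructure G (fun K => coind V K) where
  res h := res h
  ind h := ind h
  conj g _ _ h := conj g h
  res_self {K} h f := by
    ext H y
    by_cases hy : (H : Subgroup G) ≤ MulAut.conj y • K
    · rw [res_apply _ _ hy]
    · rw [apply_of_not_le _ hy, apply_of_not_le _ hy]
  ind_self h f := by
    ext H y
    rw [ind_apply, cosetSum_self, mul_one]
    intro g l hl
    rw [← mul_assoc, apply_mul_mem f H _ hl]
  res_res {L K K'} hL hK f := by
    ext H y
    by_cases hy : (H : Subgroup G) ≤ MulAut.conj y • L
    · rw [res_apply _ _ hy, res_apply _ _ hy, res_apply _ _ (le_conj_smul_mono hL hy)]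
    · rw [apply_of_not_le _ hy, apply_of_not_le _ hy]
  ind_ind {L K K'} hL hK f := by
    ext H y
    simp only [ind_apply, mul_assoc]
    refine cosetSum_trans (ψ := fun g => f.1 H (y * g)) hL hK fun g l hl => ?_
    rw [← mul_assoc, apply_mul_mem f H _ hl]
  conj_of_mem g hg h f := by
    ext H y
    exact apply_mul_mem f H y hg
  conj_conj g g' _ _ _ h h' h'' f := by
    ext H y
    exact congrArg (f.1 H) (mul_assoc _ _ _)
  conj_res g K K₁ K' K₁' hKH hKH' hK hH f := by
    ext H y
    by_cases hy : (H : Subgroup G) ≤ MulAut.conj y • K'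
    · rw [res_apply _ _ hy]
      exact res_apply hKH f ((le_conj_mul_smul_iff hK).2 hy)
    · rw [apply_of_not_le _ hy, apply_of_not_le _ hy]
  conj_ind g K K₁ K' K₁' hKH hKH' hK hH f := by
    ext H y
    refine Eq.trans ?_ (Eq.trans (cosetSum_conj (ψ := fun x => f.1 H (y * x)) g hH hK
      fun x l hl => ?_).symm ?_)
    · simp only [← mul_assoc]
      rfl
    · rw [← mul_assoc, apply_mul_mem f H _ hl]
    · simp only [← mul_assoc]
      rfl
  res_ind {K L K'} hK hL f := by
    have : Finite (DoubleCoset.Quotient (K.subgroupOf K' : Set K') (L.subgroupOf K' : Set K')) :=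
      Quotient.finite _
    let := Fintype.ofFinite
      (DoubleCoset.Quotient (K.subgroupOf K' : Set K') (L.subgroupOf K' : Set K'))
    rw [finsum_eq_sum_of_fintype]
    ext H y
    change _ = eval H y _
    by_cases hy : (H : Subgroup G) ≤ MulAut.conj y • K
    · rw [res_apply hK _ hy, map_sum, ind_apply,
        cosetSum_doubleCoset (ψ := fun g => f.1 H (y * g)) hK fun g l hl => by
          rw [← mul_assoc, apply_mul_mem f H _ hl]]
      refine Finset.sum_congr rfl fun x _ => ?_
      generalize ((Quotient.out x : K') : G) = x
      refine Eq.trans (cosetSum_congr fun k hk => ?_) (ind_apply inf_le_left _ H y).symm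
      -- Truncating to `K ∩ ˣL` loses nothing: `H` lies in the conjugate of `K` by `y * k`, so the
      -- truncation condition reduces to the support condition of `f` at `y * k * x`.
      by_cases hx : (H : Subgroup G) ≤ MulAut.conj (y * k) • (K ⊓ MulAut.conj x • L)
      · rw [res_apply _ _ hx, ← mul_assoc]
        rfl
      · rw [apply_of_not_le _ hx, apply_of_not_le]
        intro h
        refine hx ?_
        rw [Subgroup.smul_inf, ← conj_mul_smul, mul_assoc]
        exact le_inf ((le_conj_mul_smul_of_mem_iff hk).2 hy) h
    · rw [apply_of_not_le _ hy]
      exact (apply_of_not_le _ hy).symm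

end Finite

end coind

variable [Finite G]

/-- The right adjoint of the Brauer quotient functor on objects, in a larger universe. -/
noncomputable def coindModule (V : ∀ H : T, ModuleCat.{v} (R.skewRing (H : Subgroup G))) :
    MackeyModule.{u, max u v, w} R where
  obj K := coind V K
  str := coind.str V
  res_smul {L K} h r f := by
    ext H y
    by_cases hy : (H : Subgroup G) ≤ MulAut.conj y • L
    · refine (coind.res_apply h _ hy).trans ?_
      rw [coind.smul_apply, coind.smul_apply, R.str.pull_res h hy]
      exact congrArg _ (coind.res_apply h f hy).symm
    · rw [coind.apply_of_not_le _ hy, coind.apply_of_not_le _ hy]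
  conj_smul g {K K'} h r f := by
    ext H y
    rw [coind.smul_apply, R.str.pull_conj]
    rfl
  ind_res_smul {L K} h r f := by
    ext H y
    refine (coind.ind_apply h _ _ _).trans ?_
    refine Eq.trans (cosetSum_congr fun g hg => ?_) (map_cosetSum (DistribSMul.toAddMonoidHom (V H)
      (R.coeffHom (H : Subgroup G) (R.str.pull H y K r))) K L fun g => f.1 H (y * g)).symm
    rw [coind.smul_apply, DistribSMul.toAddMonoidHom_apply]
    by_cases hy : (H : Subgroup G) ≤ MulAut.conj (y * g) • L
    · rw [R.str.pull_res h hy, R.str.pull_mul_mem _ _ hg]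
    · rw [coind.apply_of_not_le _ hy, smul_zero, smul_zero]
  ind_smul_res {L K} h r f := by
    ext H y
    rw [coind.smul_apply]
    -- The reduced Mackey formula applied to `R` itself, which is possible because `coeffHom` kills
    -- elements induced from proper subgroups.
    refine Eq.trans ?_ (congrArg (· • f.1 H y) (R.str.map_pull_ind
      (R.coeffHom (H : Subgroup G)).toAddMonoidHom (fun _ => R.coeffHom_eq_zero) y h r)).symm
    refine (coind.ind_apply h _ _ _).trans ?_
    refine Eq.trans (cosetSum_congr fun g hg => ?_) (map_cosetSum
      ((smulAddHom (R.skewRing (H : Subgroup G)) (V H)).flip (f.1 H y)) K L _).symm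
    rw [coind.smul_apply, AddMonoidHom.flip_apply, smulAddHom_apply]
    by_cases hy : (H : Subgroup G) ≤ MulAut.conj (y * g) • L
    · refine congrArg _ ((coind.res_apply h f hy).trans (coind.apply_mul_mem f H y hg))
    · rw [R.str.pull_of_not_le hy, map_zero, zero_smul]
      change 0 = R.coeffHom (H : Subgroup G) 0 • f.1 H y
      rw [map_zero, zero_smul]

end GreenFunctor

/-! ### Transported modules and maps out of Brauer quotients. -/

section Transport

variable {G : Type u} [Group G]

theorem MackeyStructure.mem_inducedSubgroup_transport {M : Subgroup G → Type v'}
    [∀ H, AddCommGroup (M H)] (S : MackeyStructure G M) {N : Subgroup G → Type v}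
    [∀ H, AddCommGroup (N H)] (e : ∀ H, N H ≃+ M H) {H : Subgroup G} {x : N H} :
    x ∈ (S.transport e).inducedSubgroup H ↔ e H x ∈ S.inducedSubgroup H := by
  refine ⟨fun hx => ?_, fun hx => ?_⟩
  · have h1 : (S.transport e).inducedSubgroup H ≤
        (S.inducedSubgroup H).comap (e H).toAddMonoidHom := by
      refine MackeyStructure.inducedSubgroup_le _ fun K hK m => ?_
      have h2 : e H ((S.transport e).ind hK.le m) = S.ind hK.le (e K m) :=
        (e H).apply_symm_apply _
      rw [AddSubgroup.mem_comap, AddEquiv.toAddMonoidHom_eq_coe, AddMonoidHom.coe_coe, h2]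
      exact S.ind_mem_inducedSubgroup hK _
    exact h1 hx
  · have h1 : S.inducedSubgroup H ≤
        ((S.transport e).inducedSubgroup H).comap (e H).symm.toAddMonoidHom := by
      refine S.inducedSubgroup_le fun K hK m => ?_
      have h2 : (e H).symm (S.ind hK.le m) = (S.transport e).ind hK.le ((e K).symm m) := by
        simp [MackeyStructure.transport]
      rw [AddSubgroup.mem_comap, AddEquiv.toAddMonoidHom_eq_coe, AddMonoidHom.coe_coe, h2]
      exact (S.transport e).ind_mem_inducedSubgroup hK _
    have h2 := h1 hx
    rwa [AddSubgroup.mem_comap, AddEquiv.toAddMonoidHom_eq_coe, AddMonoidHom.coe_coe,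
      AddEquiv.symm_apply_apply] at h2

/-- A morphism into a transported Mackey module. -/
def MackeyModule.Hom.intoTransport {R : GreenFunctor.{u, w} G} {P : MackeyModule.{u, v, w} R}
    {M : MackeyModule.{u, v', w} R} {N : Subgroup G → Type v} [∀ H, AddCommGroup (N H)]
    [∀ H, Module (R.obj H) (N H)] (e : ∀ H, N H ≃ₗ[R.obj H] M.obj H)
    (φ : ∀ H, P.obj H →ₗ[R.obj H] M.obj H)
    (hres : ∀ {K H : Subgroup G} (h : K ≤ H) (m : P.obj H),
      φ K (P.str.res h m) = M.str.res h (φ H m))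
    (hind : ∀ {K H : Subgroup G} (h : K ≤ H) (m : P.obj K),
      φ H (P.str.ind h m) = M.str.ind h (φ K m))
    (hconj : ∀ (g : G) {H K : Subgroup G} (h : MulAut.conj g • H = K) (m : P.obj H),
      φ K (P.str.conj g h m) = M.str.conj g h (φ H m)) : MackeyModule.Hom P (M.transport e) where
  app H := (e H).symm.toLinearMap.comp (φ H)
  app_res {K H} h m := congrArg (e K).symm ((hres h m).trans
    (congrArg (M.str.res h) ((e H).apply_symm_apply _).symm))
  app_ind {K H} h m := congrArg (e H).symm ((hind h m).trans
    (congrArg (M.str.ind h) ((e K).apply_symm_apply _).symm))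
  app_conj g {H K} h m := congrArg (e K).symm ((hconj g h m).trans
    (congrArg (M.str.conj g h) ((e H).apply_symm_apply _).symm))

end Transport

namespace MackeyModule

variable {G : Type u} [Group G] {R : GreenFunctor.{u, w} G} {M : MackeyModule.{u, v, w} R}
  {H : Subgroup G}

theorem hom_ext {M N : MackeyModule.{u, v, w} R} {f g : M ⟶ N}
    (h : ∀ H m, Hom.app f H m = Hom.app g H m) : f = g :=
  Hom.ext (funext fun H => LinearMap.ext (h H))

/-- The map from the Brauer quotient induced by an additive map that kills induced elements. -/
def brauerLift {A : Type*} [AddCommGroup A] (f : M.obj H →+ A)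
    (hf : ∀ x ∈ M.str.inducedSubgroup H, f x = 0) : M.brauerQuotient H →+ A :=
  QuotientAddGroup.lift (M.brauerSubmodule H).toAddSubgroup f hf

theorem brauerLift_mk {A : Type*} [AddCommGroup A] (f : M.obj H →+ A)
    (hf : ∀ x ∈ M.str.inducedSubgroup H, f x = 0) (m : M.obj H) :
    brauerLift f hf (M.brauerMk H m) = f m := rfl

end MackeyModule

/-! ### The adjunction between Brauer quotients and coinduction. -/

namespace GreenFunctor

variable {G : Type u} [Group G] {R : GreenFunctor.{u, w} G} {T : Set (Subgroup G)}

/-- The map between values of the right adjoint induced by a morphism. -/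
noncomputable def coindMap {V V' : ∀ H : T, ModuleCat.{v} (R.skewRing (H : Subgroup G))}
    (φ : V ⟶ V') (K : Subgroup G) : coind V K →ₗ[R.obj K] coind V' K where
  toFun f := ⟨fun H y => (φ H).hom (f.1 H y),
    fun H y h => by
      dsimp only
      rw [coind.apply_of_not_le f h, map_zero],
    fun H y k hk => by
      dsimp only
      rw [coind.apply_mul_mem f H y hk],
    fun H y n => by
      dsimp only
      rw [coind.apply_normalizer_mul, map_smul]⟩
  map_add' f f' := by
    ext H y
    exact map_add (φ H).hom _ _
  map_smul' r f := by
    ext H y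
    exact map_smul (φ H).hom _ _

theorem coindMap_apply {V V' : ∀ H : T, ModuleCat.{v} (R.skewRing (H : Subgroup G))}
    (φ : V ⟶ V') {K : Subgroup G} (f : coind V K) (H : T) (y : G) :
    (coindMap φ K f).1 H y = (φ H).hom (f.1 H y) := rfl

theorem coindMap_res {V V' : ∀ H : T, ModuleCat.{v} (R.skewRing (H : Subgroup G))}
    (φ : V ⟶ V') {L K : Subgroup G} (h : L ≤ K) (f : coind V K) :
    coindMap φ L (coind.res h f) = coind.res h (coindMap φ K f) := by
  ext H y
  by_cases hy : (H : Subgroup G) ≤ MulAut.conj y • L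
  · rw [coind.res_apply _ _ hy, coindMap_apply, coind.res_apply _ _ hy, coindMap_apply]
  · rw [coind.apply_of_not_le _ hy, coind.apply_of_not_le _ hy]

variable (T) in
/-- The unit of the adjunction at `K`, before shrinking. -/
noncomputable def coindUnit (M : MackeyModule.{u, v, w} R) (K : Subgroup G) :
    M.obj K →ₗ[R.obj K] coind ((MackeyModule.brauer R T).obj M) K where
  toFun m := ⟨fun H y => M.brauerMk H (M.str.pull H y K m),
    fun H y h => by
      dsimp only
      rw [M.str.pull_of_not_le h, map_zero]
      rfl,
    fun H y k hk => by
      dsimp only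
      rw [M.str.pull_mul_mem _ _ hk],
    fun H y n => by
      dsimp only
      rw [M.str.pull_normalizer_mul, MackeyModule.brauerMk_conj]
      rfl⟩
  map_add' m m' := by
    ext H y
    change M.brauerMk H (M.str.pull H y K (m + m')) = M.brauerMk H _ + M.brauerMk H _
    rw [map_add, map_add]
  map_smul' r m := by
    ext H y
    change M.brauerMk H (M.str.pull H y K (r • m)) =
      R.coeffHom H (R.str.pull H y K r) • M.brauerMk H (M.str.pull H y K m)
    rw [← MackeyModule.brauerMk_smul]
    by_cases hy : (H : Subgroup G) ≤ MulAut.conj y • K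
    · rw [M.str.pull_of_le rfl hy, M.str.pull_of_le rfl hy, R.str.pull_of_le rfl hy,
        M.conj_smul, M.res_smul]
    · rw [M.str.pull_of_not_le hy, M.str.pull_of_not_le hy, smul_zero]

theorem coindUnit_apply (M : MackeyModule.{u, v, w} R) {K : Subgroup G} (m : M.obj K) (H : T)
    (y : G) : (coindUnit T M K m).1 H y = M.brauerMk H (M.str.pull H y K m) := rfl

theorem coindUnit_res (M : MackeyModule.{u, v, w} R) {L K : Subgroup G} (h : L ≤ K)
    (m : M.obj K) : coindUnit T M L (M.str.res h m) = coind.res h (coindUnit T M K m) := by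
  ext H y
  by_cases hy : (H : Subgroup G) ≤ MulAut.conj y • L
  · rw [coind.res_apply _ _ hy, coindUnit_apply, coindUnit_apply, M.str.pull_res h hy]
  · rw [coind.apply_of_not_le _ hy, coind.apply_of_not_le _ hy]

theorem coindUnit_conj (M : MackeyModule.{u, v, w} R) (g : G) {K K' : Subgroup G}
    (h : MulAut.conj g • K = K') (m : M.obj K) :
    coindUnit T M K' (M.str.conj g h m) = coind.conj g h (coindUnit T M K m) := by
  ext H y
  rw [coindUnit_apply, M.str.pull_conj]
  rfl

variable [Finite G] (V : ∀ H : T, ModuleCat.{v} (R.skewRing (H : Subgroup G)))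

/-- As `G` is finite, these are finite products of the `V H` up to bijection, hence `v`-small
although `G` lives in universe `u`. Shrinking then brings the right adjoint back to universe `v`. -/
instance (K : Subgroup G) : Small.{v} (coind V K) :=
  have : Small.{v} (∀ H : T, G → V H) := inferInstance
  inferInstanceAs (Small.{v} {f // f ∈ coind V K})

/-- The right adjoint of the Brauer quotient functor on objects. -/
noncomputable def coindObj : MackeyModule.{u, v, w} R :=
  (coindModule V).transport (N := fun K => Shrink.{v} (coind V K))
    fun K => Shrink.linearEquiv (R.obj K) (coind V K)

/-- The values of the right adjoint. -/
noncomputable def coindEquiv (K : Subgroup G) : (coindObj V).obj K ≃ₗ[R.obj K] coind V K :=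
  Shrink.linearEquiv (R.obj K) (coind V K)

theorem coindEquiv_res {L K : Subgroup G} (h : L ≤ K) (f : (coindObj V).obj K) :
    coindEquiv V L ((coindObj V).str.res h f) = coind.res h (coindEquiv V K f) :=
  (coindEquiv V L).apply_symm_apply _

theorem coindEquiv_ind {L K : Subgroup G} (h : L ≤ K) (f : (coindObj V).obj L) :
    coindEquiv V K ((coindObj V).str.ind h f) = coind.ind h (coindEquiv V L f) :=
  (coindEquiv V K).apply_symm_apply _

theorem coindEquiv_conj (g : G) {K K' : Subgroup G} (h : MulAut.conj g • K = K')
    (f : (coindObj V).obj K) :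
    coindEquiv V K' ((coindObj V).str.conj g h f) = coind.conj g h (coindEquiv V K f) :=
  (coindEquiv V K').apply_symm_apply _

/-- Every value of `f` is a value at `1` of a restricted conjugate of `f`; this is the second
triangle identity. -/
theorem coindEquiv_pull (H : T) (y : G) {K : Subgroup G} (f : (coindObj V).obj K) :
    (coindEquiv V H ((coindObj V).str.pull H y K f)).1 H 1 = (coindEquiv V K f).1 H y := by
  by_cases hy : (H : Subgroup G) ≤ MulAut.conj y • K
  · rw [MackeyStructure.pull_of_le _ rfl hy, coindEquiv_res, coindEquiv_conj,
      coind.res_apply _ _ (by simp)]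
    exact congrArg ((coindEquiv V K f).1 H) (one_mul _)
  · rw [MackeyStructure.pull_of_not_le _ hy, map_zero, coind.apply_of_not_le _ hy]
    rfl

theorem mem_inducedSubgroup_coindObj {K : Subgroup G} {f : (coindObj V).obj K} :
    f ∈ (coindObj V).str.inducedSubgroup K ↔
      coindEquiv V K f ∈ (coind.str V).inducedSubgroup K :=
  MackeyStructure.mem_inducedSubgroup_transport _ _

variable {V}

/-- The value at `1` of an element induced from `L < H` is a sum of values at elements `g ∈ H`; a
nonzero one would force `H ≤ ᵍL`, that is, `H ≤ L`. So evaluation at `1` descends to the Brauer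
quotient. -/
theorem coind_apply_one_of_mem_inducedSubgroup {H : T} {f : coind V (H : Subgroup G)}
    (hf : f ∈ (coind.str V).inducedSubgroup H) : f.1 H 1 = 0 := by
  have h1 : (coind.str V).inducedSubgroup H ≤ (coind.eval (K := (H : Subgroup G)) H 1).ker := by
    refine MackeyStructure.inducedSubgroup_le _ fun L hL f => ?_
    rw [AddMonoidHom.mem_ker]
    refine (coind.ind_apply hL.le f H 1).trans ?_
    rw [← cosetSum_zero (H : Subgroup G) L]
    refine cosetSum_congr fun g hg => coind.apply_of_not_le f fun h => hL.not_ge ?_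
    rw [one_mul] at h
    nth_rw 1 [← conj_smul_eq_of_mem hg] at h
    exact Subgroup.pointwise_smul_le_pointwise_smul_iff.1 h
  exact h1 hf

theorem coindMap_ind {V V' : ∀ H : T, ModuleCat.{v} (R.skewRing (H : Subgroup G))}
    (φ : V ⟶ V') {L K : Subgroup G} (h : L ≤ K) (f : coind V L) :
    coindMap φ K (coind.ind h f) = coind.ind h (coindMap φ L f) := by
  ext H y
  exact map_cosetSum (φ H).hom.toAddMonoidHom K L fun g => f.1 H (y * g)

variable (R T) in
/-- The right adjoint of the Brauer quotient functor. -/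
noncomputable def coindFunctor :
    (∀ H : T, ModuleCat.{v} (R.skewRing (H : Subgroup G))) ⥤ MackeyModule.{u, v, w} R where
  obj V := coindObj V
  map {V V'} φ := MackeyModule.Hom.intoTransport _
    (fun K => (coindMap φ K).comp (coindEquiv V K).toLinearMap)
    (fun {L K} h f => (congrArg (coindMap φ L) (coindEquiv_res V h f)).trans (coindMap_res φ h _))
    (fun {L K} h f => (congrArg (coindMap φ K) (coindEquiv_ind V h f)).trans (coindMap_ind φ h _))
    (fun g {L K} h f => congrArg (coindMap φ K) (coindEquiv_conj V g h f))
  map_id V := MackeyModule.hom_ext fun K f => (coindEquiv V K).symm_apply_apply f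
  map_comp {V V' V''} φ ψ := MackeyModule.hom_ext fun K f => by
    refine congrArg (coindEquiv V'' K).symm ?_
    refine Eq.trans ?_ (congrArg (coindMap ψ K)
      ((coindEquiv V' K).apply_symm_apply (coindMap φ K (coindEquiv V K f)))).symm
    rfl

theorem coindEquiv_map {V V' : ∀ H : T, ModuleCat.{v} (R.skewRing (H : Subgroup G))}
    (φ : V ⟶ V') {K : Subgroup G} (f : (coindObj V).obj K) :
    coindEquiv V' K (MackeyModule.Hom.app ((coindFunctor R T).map φ) K f) =
      coindMap φ K (coindEquiv V K f) :=
  (coindEquiv V' K).apply_symm_apply _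

/-- Induction on the coinduced side is defined by exactly the coset sum to which the Mackey formula
reduces in a Brauer quotient. -/
theorem coindUnit_ind (M : MackeyModule.{u, v, w} R) {L K : Subgroup G} (h : L ≤ K)
    (m : M.obj L) : coindUnit T M K (M.str.ind h m) = coind.ind h (coindUnit T M L m) := by
  ext H y
  exact M.str.map_pull_ind (M.brauerMk H)
    (fun x hx => MackeyModule.brauerMk_eq_zero_iff.2 hx) y h m

variable (T) in
/-- The component of the unit of the adjunction at a Mackey module. -/
noncomputable def unitHom (M : MackeyModule.{u, v, w} R) :
    MackeyModule.Hom M (coindObj ((MackeyModule.brauer R T).obj M)) :=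
  MackeyModule.Hom.intoTransport _ (fun K => coindUnit T M K) (coindUnit_res M)
    (coindUnit_ind M) (coindUnit_conj M)

theorem coindEquiv_unitHom (M : MackeyModule.{u, v, w} R) {K : Subgroup G} (m : M.obj K) :
    coindEquiv _ K ((unitHom T M).app K m) = coindUnit T M K m :=
  (coindEquiv _ K).apply_symm_apply _

variable (V) in
/-- Evaluation at the identity. -/
noncomputable def evalOne (H : T) : (coindObj V).obj (H : Subgroup G) →+ V H :=
  (coind.eval H 1).comp (coindEquiv V H : (coindObj V).obj (H : Subgroup G) →+ coind V H)

theorem evalOne_apply {H : T} (f : (coindObj V).obj (H : Subgroup G)) :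
    evalOne V H f = (coindEquiv V H f).1 H 1 := rfl

theorem evalOne_eq_zero {H : T} {f : (coindObj V).obj (H : Subgroup G)}
    (hf : f ∈ (coindObj V).str.inducedSubgroup H) : evalOne V H f = 0 :=
  coind_apply_one_of_mem_inducedSubgroup ((mem_inducedSubgroup_coindObj V).1 hf)

variable (V) in
/-- The component of the counit of the adjunction at `H`. -/
noncomputable def counitMap (H : T) :
    (coindObj V).brauerQuotient (H : Subgroup G) →ₗ[R.skewRing (H : Subgroup G)] V H :=
  R.skewLinearMap
    (MackeyModule.brauerLift (evalOne V H) fun _ => evalOne_eq_zero)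
    (fun r x => by
      obtain ⟨f, rfl⟩ := MackeyModule.brauerMk_surjective _ _ x
      rw [← MackeyModule.brauerMk_smul, MackeyModule.brauerLift_mk, MackeyModule.brauerLift_mk]
      rw [evalOne_apply, evalOne_apply, map_smul, coind.smul_apply, R.str.pull_one_self])
    (fun n x => by
      obtain ⟨f, rfl⟩ := MackeyModule.brauerMk_surjective _ _ x
      rw [← MackeyModule.brauerMk_conj, MackeyModule.brauerLift_mk, MackeyModule.brauerLift_mk]
      rw [evalOne_apply, evalOne_apply, coindEquiv_conj, ← coind.apply_normalizer_mul, mul_one]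
      exact congrArg ((coindEquiv V H f).1 H) (one_mul _))

theorem counitMap_mk (H : T) (f : (coindObj V).obj (H : Subgroup G)) :
    counitMap V H ((coindObj V).brauerMk H f) = (coindEquiv V H f).1 H 1 := rfl

variable (R T) in
/-- The adjunction between the Brauer quotient functor and `coindFunctor`. -/
noncomputable def brauerAdjunction :
    MackeyModule.brauer.{u, v, w} R T ⊣ coindFunctor R T where
  unit :=
    { app M := unitHom T M
      naturality M N f := MackeyModule.hom_ext fun K m => by
        apply (coindEquiv _ K).injective
        refine (coindEquiv_unitHom N _).trans ?_
        refine Eq.trans ?_ ((coindEquiv_map _ _).trans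
          (congrArg (coindMap _ K) (coindEquiv_unitHom M m))).symm
        refine coind.ext fun H y => ?_
        refine congrArg (N.brauerMk H) ?_
        change N.str.pull H y K (MackeyModule.Hom.app f K m) =
          MackeyModule.Hom.app f H (M.str.pull H y K m)
        by_cases hy : (H : Subgroup G) ≤ MulAut.conj y • K
        · rw [M.str.pull_of_le rfl hy, N.str.pull_of_le rfl hy, f.app_res, f.app_conj]
        · rw [M.str.pull_of_not_le hy, N.str.pull_of_not_le hy, map_zero] }
  counit :=
    { app V := fun H => ModuleCat.ofHom (counitMap V H)
      naturality V V' φ := funext fun H => ModuleCat.hom_ext (LinearMap.ext fun x => by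
        obtain ⟨f, rfl⟩ := MackeyModule.brauerMk_surjective (coindObj V) H x
        refine (counitMap_mk (V := V') H _).trans ?_
        rw [coindEquiv_map]
        rfl) }
  left_triangle_components M := funext fun H => ModuleCat.hom_ext (LinearMap.ext fun x => by
    obtain ⟨m, rfl⟩ := MackeyModule.brauerMk_surjective M H x
    refine (counitMap_mk H _).trans ?_
    refine (congrArg (fun f => f.1 H 1) (coindEquiv_unitHom M m)).trans ?_
    rw [coindUnit_apply, M.str.pull_one_self]
    rfl)
  right_triangle_components V := MackeyModule.hom_ext fun K f => by
    apply (coindEquiv V K).injective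
    refine (coindEquiv_map _ _).trans ?_
    refine coind.ext fun H y => ?_
    rw [coindMap_apply]
    refine (congrArg (fun f => (counitMap V H) (f.1 H y)) (coindEquiv_unitHom _ f)).trans ?_
    refine (counitMap_mk H ((coindObj V).str.pull H y K f)).trans ?_
    exact coindEquiv_pull V H y f

end GreenFunctor

/-! ### Bijectivity of the unit and counit under divisibility. -/

/-- Each coset of `L` has `|L|` elements. The resulting sum over all of `K` has an index set
independent of `L`. -/
theorem card_smul_cosetSum {G : Type u} [Group G] [Finite G] {A : Type*} [AddCommGroup A]
    {L K : Subgroup G} (h : L ≤ K) {ψ : G → A} (hψ : ∀ g, ∀ l ∈ L, ψ (g * l) = ψ g) :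
    Nat.card L • cosetSum K L ψ = cosetSum K ⊥ ψ := by
  rw [← cosetSum_trans bot_le h (fun g l hl => by rw [Subgroup.mem_bot.1 hl, mul_one])]
  refine (map_cosetSum (DistribSMul.toAddMonoidHom A (Nat.card L)) K L ψ).trans ?_
  refine cosetSum_congr fun g _ => ?_
  rw [cosetSum_congr (ψ' := fun _ => ψ g) (fun l hl => hψ g l hl), cosetSum_const,
    Subgroup.relIndex_bot_left]
  rfl

namespace GreenFunctor

variable {G : Type u} [Group G] {R : GreenFunctor.{u, w} G} {T : Set (Subgroup G)}
  {V : ∀ H : T, ModuleCat.{v} (R.skewRing (H : Subgroup G))}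

namespace coind

open Classical in
/-- The part of an element of `coind V K` supported on `{y | ʸL = H}`. -/
noncomputable def part {K : Subgroup G} (f : coind V K) {L : Subgroup G} (hL : L ≤ K) :
    coind V L :=
  ⟨fun H y => if MulAut.conj y • L = H then f.1 H y else 0,
    fun H y h => if_neg fun h' => h h'.ge,
    fun H y l hl => by simp only [conj_mul_smul_of_mem y hl, apply_mul_mem f H y (hL hl)],
    fun H y n => by
      have h : MulAut.conj ((n : G) * y) • L = H ↔ MulAut.conj y • L = H := by
        rw [conj_mul_smul]
        nth_rw 2 [← conj_smul_eq_of_mem_normalizer n]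
        exact smul_left_cancel_iff _
      simp only [h, apply_normalizer_mul]
      split_ifs <;> simp⟩

open Classical in
theorem part_apply {K : Subgroup G} (f : coind V K) {L : Subgroup G} (hL : L ≤ K) (H : T)
    (y : G) : (part f hL).1 H y = if MulAut.conj y • L = H then f.1 H y else 0 := rfl

variable [Finite G]

/-- If an element divisible by `|K|` vanishes on `{y | ʸK = H}`, then it is a sum of elements
induced from proper subgroups. -/
theorem mem_inducedSubgroup {K : Subgroup G} {f f' : coind V K} (hf : Nat.card K • f' = f)
    (h : ∀ (H : T) (y : G), MulAut.conj y • K = H → f.1 H y = 0) :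
    f ∈ (coind.str V).inducedSubgroup K := by
  classical
  let := Fintype.ofFinite (Set.Iio K)
  -- At `(H, y)` the term of `L` contributes `f'_H(y)` once for each `g ∈ K` whose product `y * g`
  -- conjugates `L` to `H`; the factor `|L|` compensates for summing over cosets only.
  have hsum : f = ∑ L : Set.Iio K, (coind.str V).ind (Set.mem_Iio.1 L.2).le
      (Nat.card (L : Subgroup G) • part f' (Set.mem_Iio.1 L.2).le) := by
    ext H y
    have hfy : f.1 H y = Nat.card K • f'.1 H y := by
      rw [← hf]
      exact map_nsmul (eval (K := K) H y) _ _
    change _ = eval H y _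
    rw [map_sum]
    have hterm : ∀ L : Set.Iio K, eval H y ((coind.str V).ind (Set.mem_Iio.1 L.2).le
        (Nat.card (L : Subgroup G) • part f' (Set.mem_Iio.1 L.2).le)) =
        cosetSum K ⊥ fun g => if MulAut.conj (y * g) • (L : Subgroup G) = H
          then f'.1 H y else 0 := fun L => by
      rw [map_nsmul, map_nsmul]
      refine (card_smul_cosetSum (ψ := fun g => (part f' (Set.mem_Iio.1 L.2).le).1 H (y * g))
        (Set.mem_Iio.1 L.2).le fun g l hl => ?_).trans (cosetSum_congr fun g hg => ?_)
      · rw [← mul_assoc, apply_mul_mem _ _ _ hl]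
      · rw [part_apply, apply_mul_mem f' H y hg]
    rw [Finset.sum_congr rfl fun L _ => hterm L]
    have hswap : ∑ L : Set.Iio K, cosetSum K ⊥ (fun g =>
        if MulAut.conj (y * g) • (L : Subgroup G) = H then f'.1 H y else 0) =
        cosetSum K ⊥ fun g => ∑ L : Set.Iio K,
          if MulAut.conj (y * g) • (L : Subgroup G) = H then f'.1 H y else 0 :=
      Finset.sum_comm
    rw [hswap]
    -- Each `g ∈ K` singles out one candidate, the conjugate of `H` by `(y * g)⁻¹`. It is a proper
    -- subgroup of `K` exactly when `H < ʸK`, and then the total is `|K| f'_H(y) = f_H(y)`. In the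
    -- remaining cases both sides vanish.
    by_cases hle : (H : Subgroup G) ≤ MulAut.conj y • K
    · by_cases heq : MulAut.conj y • K = H
      · rw [h H y heq]
        refine (cosetSum_zero K ⊥).symm.trans ?_
        refine cosetSum_congr fun g hg => (Finset.sum_eq_zero fun L _ => if_neg fun hL => ?_).symm
        refine (Set.mem_Iio.1 L.2).ne (smul_left_cancel (MulAut.conj (y * g)) ?_)
        rw [hL, conj_mul_smul_of_mem y hg, heq]
      · rw [hfy, ← Subgroup.relIndex_bot_left, ← cosetSum_const]
        refine cosetSum_congr fun g hg => ?_
        have hlt : (MulAut.conj (y * g))⁻¹ • (H : Subgroup G) < K := by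
          refine lt_of_le_of_ne ?_ fun h' => heq ?_
          · rw [Subgroup.pointwise_smul_subset_iff, inv_inv, conj_mul_smul_of_mem y hg]
            exact hle
          · rw [← conj_mul_smul_of_mem y hg, ← h', smul_inv_smul]
        rw [Finset.sum_eq_single (⟨_, hlt⟩ : Set.Iio K)]
        · rw [if_pos (smul_inv_smul _ _)]
        · intro L _ hL
          exact if_neg fun h' => hL (Subtype.ext (eq_inv_smul_iff.2 h'))
        · simp
    · rw [apply_of_not_le _ hle, apply_of_not_le _ hle]
      simp [cosetSum_zero]
  rw [hsum]
  exact sum_mem fun L _ => (coind.str V).ind_mem_inducedSubgroup (Set.mem_Iio.1 L.2) _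

end coind

/-- Extend `n ↦ n • x` from `N_G(H)` by zero, and take zero in the other components. Right
`H`-invariance holds because `H` acts trivially through the Weyl group. -/
theorem exists_coind_apply_one_eq (H : T) (x : V H) :
    ∃ f : coind V (H : Subgroup G), f.1 H 1 = x := by
  classical
  let N := Subgroup.normalizer ((H : Subgroup G) : Set G)
  let φ : G → V H := fun y => if h : y ∈ N then R.normalizerHom (H : Subgroup G) ⟨y, h⟩ • x else 0
  have hmul : ∀ (n : N) (y : G), φ (n * y) = R.normalizerHom (H : Subgroup G) n • φ y := by
    intro n y
    by_cases hy : y ∈ N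
    · have hny : (n : G) * y ∈ N := mul_mem n.2 hy
      simp only [φ, dif_pos hy, dif_pos hny]
      rw [smul_smul, ← map_mul]
      rfl
    · have hny : (n : G) * y ∉ N := fun h => hy ((Subgroup.mul_mem_cancel_left N n.2).1 h)
      simp only [φ, dif_neg hy, dif_neg hny, smul_zero]
  have hone : ∀ k ∈ (H : Subgroup G), φ k = x := by
    intro k hk
    have hk' : k ∈ N := Subgroup.le_normalizer hk
    simp only [φ, dif_pos hk']
    rw [R.normalizerHom_eq_one hk, one_smul]
  refine ⟨⟨Pi.single H φ, fun H' y h => ?_, fun H' y k hk => ?_, fun H' y n => ?_⟩, ?_⟩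
  · by_cases hH : H' = H
    · subst hH
      rw [Pi.single_eq_same]
      refine dif_neg fun hy => h ?_
      exact (conj_smul_eq_of_mem_normalizer ⟨y, hy⟩).ge
    · rw [Pi.single_eq_of_ne hH]
      rfl
  · by_cases hH : H' = H
    · subst hH
      rw [Pi.single_eq_same]
      by_cases hy : y ∈ N
      · rw [hmul ⟨y, hy⟩, hone k hk, ← hone 1 (one_mem _), ← hmul, mul_one]
      · have hyk : y * k ∉ N := fun h =>
          hy ((Subgroup.mul_mem_cancel_right N (Subgroup.le_normalizer hk)).1 h)
        simp only [φ, dif_neg hy, dif_neg hyk]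
    · rw [Pi.single_eq_of_ne hH]
      rfl
  · by_cases hH : H' = H
    · subst hH
      rw [Pi.single_eq_same]
      exact hmul n y
    · rw [Pi.single_eq_of_ne hH]
      exact (smul_zero _).symm
  · change Pi.single (M := fun H : T => G → V H) H φ H 1 = x
    rw [Pi.single_eq_same]
    exact hone 1 (one_mem _)

theorem eq_of_conj_smul_eq
    (hT : ∀ K : Subgroup G, ∃! H : Subgroup G, H ∈ T ∧ ∃ g : G, MulAut.conj g • K = H)
    {K : Subgroup G} {H H' : T} {g g' : G}
    (h : MulAut.conj g • K = H) (h' : MulAut.conj g' • K = H') : H = H' :=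
  Subtype.ext ((hT K).unique ⟨H.2, g, h⟩ ⟨H'.2, g', h'⟩)

/-- The elements conjugating `K` to `H` form a single coset `N_G(H) g`, on which equivariance
propagates the zero; no other member of `T` is conjugate to `K`. -/
theorem coind_apply_eq_zero
    (hT : ∀ K : Subgroup G, ∃! H : Subgroup G, H ∈ T ∧ ∃ g : G, MulAut.conj g • K = H)
    {K : Subgroup G} {f : coind V K} {H : T} {g : G}
    (hg : MulAut.conj g • K = H) (hf : f.1 H g = 0) (H' : T) (y : G)
    (hy : MulAut.conj y • K = H') : f.1 H' y = 0 := by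
  obtain rfl := eq_of_conj_smul_eq hT hg hy
  have hn : y * g⁻¹ ∈ Subgroup.normalizer ((H : Subgroup G) : Set G) := by
    rw [Subgroup.mem_normalizer_iff_conj_image_eq]
    have h1 : MulAut.conj (y * g⁻¹) • (H : Subgroup G) = H := by
      rw [← hg, ← conj_mul_smul, inv_mul_cancel_right, hy, hg]
    exact congrArg (fun K : Subgroup G => (K : Set G)) h1
  have h2 := coind.apply_normalizer_mul f H g ⟨_, hn⟩
  rwa [hf, smul_zero, inv_mul_cancel_right] at h2

variable [Finite G]

theorem counitMap_bijective
    (hT : ∀ K : Subgroup G, ∃! H : Subgroup G, H ∈ T ∧ ∃ g : G, MulAut.conj g • K = H)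
    (H : T)
    (hdiv : ∀ f : coind V (H : Subgroup G), ∃ f', Nat.card (H : Subgroup G) • f' = f) :
    Function.Bijective (counitMap V H) := by
  classical
  refine ⟨(injective_iff_map_eq_zero _).2 fun x hx => ?_, fun x => ?_⟩
  · obtain ⟨f, rfl⟩ := MackeyModule.brauerMk_surjective _ _ x
    rw [counitMap_mk] at hx
    rw [MackeyModule.brauerMk_eq_zero_iff, mem_inducedSubgroup_coindObj]
    obtain ⟨f', hf'⟩ := hdiv (coindEquiv V H f)
    exact coind.mem_inducedSubgroup hf' (coind_apply_eq_zero hT (by simp) hx)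
  · obtain ⟨f, hf⟩ := exists_coind_apply_one_eq H x
    refine ⟨(coindObj V).brauerMk H ((coindEquiv V H).symm f), ?_⟩
    rw [counitMap_mk, LinearEquiv.apply_symm_apply, hf]

theorem coindUnit_bijective
    (hT : ∀ K : Subgroup G, ∃! H : Subgroup G, H ∈ T ∧ ∃ g : G, MulAut.conj g • K = H)
    (M : MackeyModule.{u, v, w} R)
    (hM : ∀ (K : Subgroup G) (m : M.obj K), Nat.card K • m = 0 → m = 0)
    (hdiv : ∀ (K : Subgroup G) (f : coind ((MackeyModule.brauer R T).obj M) K),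
      ∃ f', Nat.card K • f' = f) (K : Subgroup G) :
    Function.Bijective (coindUnit T M K) := by
  induction K using WellFoundedLT.induction with
  | ind K ih =>
    obtain ⟨H, ⟨hH, g, hg⟩, -⟩ := hT K
    lift H to T using hH
    -- Here `H` is the representative of the class of `K`: on the top stratum the unit reads off the
    -- class of `c_g m`, which can be prescribed freely.
    have hpull : ∀ m : M.obj H, M.str.pull H g K
        (M.str.conj g⁻¹ (by rw [← hg, ← conj_mul_smul]; simp) m) = m := fun m => by
      rw [M.str.pull_conj, mul_inv_cancel, M.str.pull_one_self]
    refine ⟨(injective_iff_map_eq_zero _).2 fun m hm => ?_, fun f => ?_⟩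
    · refine hM K m (M.str.card_smul_eq_zero ?_ fun L hL => ?_)
      -- Vanishing on the top stratum says that `c_g m` is a sum of elements induced from proper
      -- subgroups; conjugating back gives this for `m`.
      · have h1 : M.brauerMk H (M.str.pull H g K m) = 0 :=
          congrArg (fun f => f.1 H g) hm
        rw [MackeyModule.brauerMk_eq_zero_iff, M.str.pull_of_le hg le_rfl, M.str.res_self] at h1
        have h2 := M.str.conj_mem_inducedSubgroup g⁻¹
          (show MulAut.conj g⁻¹ • (H : Subgroup G) = K by rw [← hg, ← conj_mul_smul]; simp) h1
        rwa [M.str.conj_conj g g⁻¹ hg _ (by simp), M.str.conj_of_mem _ (by simp)] at h2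
      · refine (injective_iff_map_eq_zero _).1 (ih L hL).1 _ ?_
        rw [coindUnit_res, hm, map_zero]
    · obtain ⟨m, hm⟩ := M.brauerMk_surjective H (f.1 H g)
      -- After correcting the value at `(H, g)`, the difference vanishes on the whole top stratum.
      have h1 : f - coindUnit T M K (M.str.conj g⁻¹
          (by rw [← hg, ← conj_mul_smul]; simp) m) ∈ (coind.str _).inducedSubgroup K := by
        obtain ⟨f', hf'⟩ := hdiv K (f - coindUnit T M K (M.str.conj g⁻¹
          (by rw [← hg, ← conj_mul_smul]; simp) m))
        refine coind.mem_inducedSubgroup hf' (coind_apply_eq_zero hT hg ?_)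
        refine sub_eq_zero.2 (hm.symm.trans ?_)
        rw [coindUnit_apply, hpull]
      have h2 : (coind.str ((MackeyModule.brauer R T).obj M)).inducedSubgroup K ≤
          (coindUnit T M K).toAddMonoidHom.range := by
        refine MackeyStructure.inducedSubgroup_le _ fun L hL f => ?_
        obtain ⟨m, rfl⟩ := (ih L hL).2 f
        exact ⟨M.str.ind hL.le m, coindUnit_ind M hL.le m⟩
      obtain ⟨m', hm'⟩ := h2 h1
      refine ⟨m' + M.str.conj g⁻¹ (by rw [← hg, ← conj_mul_smul]; simp) m, ?_⟩
      rw [map_add]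
      exact sub_eq_iff_eq_add.1 hm'.symm |>.symm

end GreenFunctor

/-! ### Restricting an adjunction to an equivalence. -/

section Category

/-- An adjunction `L ⊣ R` restricts to an equivalence between full subcategories that are
preserved by `L` and `R` and on which the unit and the counit are isomorphisms. -/
theorem CategoryTheory.Adjunction.exists_equivalence_of_fullyFaithful
    {C D C' D' : Type*} [Category* C] [Category* D] [Category* C'] [Category* D']
    {iC : C ⥤ C'} {iD : D ⥤ D'} (hiC : iC.FullyFaithful) (hiD : iD.FullyFaithful)
    {L : C' ⥤ D'} {R : D' ⥤ C'} (adj : L ⊣ R)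
    (hL : ∀ X, iD.essImage (L.obj (iC.obj X))) (hR : ∀ Y, iC.essImage (R.obj (iD.obj Y)))
    (hunit : ∀ X, IsIso (adj.unit.app (iC.obj X)))
    (hcounit : ∀ Y, IsIso (adj.counit.app (iD.obj Y))) :
    ∃ (e : C ≌ D) (α : e.functor ⋙ iD ≅ iC ⋙ L) (β : e.inverse ⋙ iC ≅ iD ⋙ R),
      (∀ X, iC.map (e.unit.app X) ≫ β.hom.app (e.functor.obj X) ≫ R.map (α.hom.app X) =
        adj.unit.app (iC.obj X)) ∧
      (∀ Y, iD.map (e.counit.app Y) = α.hom.app (e.inverse.obj Y) ≫ L.map (β.hom.app Y) ≫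
        adj.counit.app (iD.obj Y)) := by
  have := hiC.full
  have := hiC.faithful
  have := hiD.full
  have := hiD.faithful
  -- A fully faithful functor is an equivalence onto its essential image, so the composite lands
  -- there and is pulled back along the inverse.
  let L' : C ⥤ D := iD.essImage.lift (iC ⋙ L) hL ⋙ iD.toEssImage.inv
  let R' : D ⥤ C := iC.essImage.lift (iD ⋙ R) hR ⋙ iC.toEssImage.inv
  let α : L' ⋙ iD ≅ iC ⋙ L := Functor.isoWhiskerRight
    (Functor.isoWhiskerLeft (iD.essImage.lift (iC ⋙ L) hL) iD.toEssImage.asEquivalence.counitIso)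
    iD.essImage.ι
  let β : R' ⋙ iC ≅ iD ⋙ R := Functor.isoWhiskerRight
    (Functor.isoWhiskerLeft (iC.essImage.lift (iD ⋙ R) hR) iC.toEssImage.asEquivalence.counitIso)
    iC.essImage.ι
  let adj' : L' ⊣ R' := adj.restrictFullyFaithful hiC hiD α.symm β.symm
  have hu : ∀ X, iC.map (adj'.unit.app X) = adj.unit.app (iC.obj X) ≫ R.map (α.inv.app X) ≫
      β.inv.app (L'.obj X) := adj.map_restrictFullyFaithful_unit_app hiC hiD α.symm β.symm
  have hc : ∀ Y, iD.map (adj'.counit.app Y) = α.hom.app (R'.obj Y) ≫ L.map (β.hom.app Y) ≫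
      adj.counit.app (iD.obj Y) := adj.map_restrictFullyFaithful_counit_app hiC hiD α.symm β.symm
  have hu' : ∀ X, IsIso (adj'.unit.app X) := fun X => by
    have : IsIso (iC.map (adj'.unit.app X)) := by
      rw [hu]
      infer_instance
    exact isIso_of_fully_faithful iC _
  have hc' : ∀ Y, IsIso (adj'.counit.app Y) := fun Y => by
    have : IsIso (iD.map (adj'.counit.app Y)) := by
      rw [hc]
      infer_instance
    exact isIso_of_fully_faithful iD _
  refine ⟨adj'.toEquivalence, α, β, fun X => ?_, fun Y => hc Y⟩
  have h1 : R.map (α.inv.app X) ≫ R.map (α.hom.app X) = 𝟙 _ := by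
    rw [← R.map_comp, Iso.inv_hom_id_app, R.map_id]
  calc _ = (adj.unit.app (iC.obj X) ≫ R.map (α.inv.app X) ≫ β.inv.app (L'.obj X)) ≫
        β.hom.app (L'.obj X) ≫ R.map (α.hom.app X) := congrArg (· ≫ _) (hu X)
    _ = _ := by
      simp only [Category.assoc, Iso.inv_hom_id_app_assoc]
      exact (congrArg (_ ≫ ·) h1).trans (Category.comp_id _)

end Category

/-! ### Modules over a subring of the rationals. -/

section Subring

variable {Q : Subring ℚ}

/-- By Bézout, `a * num + b * den = 1`; dividing by `den` expresses the inverse as `a * q + b`. -/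
theorem Subring.inv_den_mem (q : Q) : ((q : ℚ).den : ℚ)⁻¹ ∈ Q := by
  obtain ⟨a, b, h⟩ : IsCoprime (q : ℚ).num ((q : ℚ).den : ℤ) :=
    Int.isCoprime_iff_gcd_eq_one.2 (q : ℚ).reduced
  have hden : ((q : ℚ).den : ℚ) ≠ 0 := by exact_mod_cast (q : ℚ).den_ne_zero
  have h1 : ((q : ℚ).den : ℚ)⁻¹ = a * q + b := by
    have h2 : (a : ℚ) * (q : ℚ).num + b * (q : ℚ).den = 1 := by exact_mod_cast h
    have h3 := Rat.mul_den_eq_num (q : ℚ)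
    field_simp
    rw [← h2, ← h3]
    ring
  rw [h1]
  exact add_mem (mul_mem (intCast_mem Q a) q.2) (intCast_mem Q b)

/-- Additive maps between modules over a subring of `ℚ` are linear. -/
theorem AddMonoidHom.map_subring_smul {X Y : Type*} [AddCommGroup X] [AddCommGroup Y]
    [Module Q X] [Module Q Y] (f : X →+ Y) (q : Q) (x : X) : f (q • x) = q • f x := by
  -- Multiplication by `β` undoes multiplication by the denominator; after clearing the denominator
  -- only an integer multiple has to be moved through `f`.
  let β : Q := ⟨_, Subring.inv_den_mem q⟩
  have hden : ((q : ℚ).den : ℚ) ≠ 0 := by exact_mod_cast (q : ℚ).den_ne_zero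
  have h1 : β * ((q : ℚ).den : Q) = 1 := Subtype.ext (inv_mul_cancel₀ hden)
  have h2 : (((q : ℚ).den : Q) * q) = (((q : ℚ).num : ℤ) : Q) := Subtype.ext (by
    push_cast
    rw [mul_comm]
    exact Rat.mul_den_eq_num _)
  calc f (q • x) = β • ((q : ℚ).den : Q) • f (q • x) := by rw [smul_smul, h1, one_smul]
    _ = β • f ((((q : ℚ).den : Q) * q) • x) := by
      rw [mul_smul, Nat.cast_smul_eq_nsmul, Nat.cast_smul_eq_nsmul, map_nsmul]
    _ = β • ((((q : ℚ).den : Q) * q) • f x) := by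
      rw [h2, Int.cast_smul_eq_zsmul, Int.cast_smul_eq_zsmul, map_zsmul]
    _ = q • f x := by rw [smul_smul, ← mul_assoc, h1, one_mul]

theorem Subring.inv_natCast_mem_of_dvd {m n : ℕ} (hn : (n : ℚ)⁻¹ ∈ Q) (hmn : m ∣ n)
    (hn0 : n ≠ 0) : (m : ℚ)⁻¹ ∈ Q := by
  obtain ⟨k, rfl⟩ := hmn
  obtain ⟨hm, hk⟩ := mul_ne_zero_iff.1 hn0
  have h1 : (m : ℚ)⁻¹ = k * ((m * k : ℕ) : ℚ)⁻¹ := by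
    have : (m : ℚ) ≠ 0 := by exact_mod_cast hm
    have : (k : ℚ) ≠ 0 := by exact_mod_cast hk
    push_cast
    field_simp
  rw [h1]
  exact mul_mem (natCast_mem Q k) hn

theorem exists_nsmul_eq_of_inv_mem {n : ℕ} (hn : (n : ℚ)⁻¹ ∈ Q) (hn0 : n ≠ 0) {X : Type*}
    [AddCommGroup X] [Module Q X] (x : X) : ∃ y : X, n • y = x := by
  refine ⟨(⟨_, hn⟩ : Q) • x, ?_⟩
  rw [← Nat.cast_smul_eq_nsmul Q, smul_smul]
  have h1 : (n : Q) * ⟨_, hn⟩ = 1 := Subtype.ext (mul_inv_cancel₀ (Nat.cast_ne_zero.2 hn0))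
  rw [h1, one_smul]

theorem eq_zero_of_nsmul_eq_zero_of_inv_mem {n : ℕ} (hn : (n : ℚ)⁻¹ ∈ Q) (hn0 : n ≠ 0)
    {X : Type*} [AddCommGroup X] [Module Q X] {x : X} (hx : n • x = 0) : x = 0 := by
  have h1 : (⟨_, hn⟩ : Q) * (n : Q) = 1 := Subtype.ext (inv_mul_cancel₀ (Nat.cast_ne_zero.2 hn0))
  rw [← one_smul Q x, ← h1, mul_smul, Nat.cast_smul_eq_nsmul, hx, smul_zero]

/-- `Nonempty` is enough: by `AddMonoidHom.map_subring_smul` for the identity, an abelian group has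
at most one `Q`-module structure. -/
theorem nonempty_module_of_surjective {X Y : Type*} [AddCommGroup X] [AddCommGroup Y]
    [Module Q X] (f : X →+ Y) (hf : Function.Surjective f)
    (hker : ∀ (q : Q) x, f x = 0 → f (q • x) = 0) : Nonempty (Module Q Y) := by
  let : SMul Q Y := ⟨fun q y => f (q • Function.surjInv hf y)⟩
  refine ⟨hf.module Q f fun q x => ?_⟩
  change f (q • x) = f (q • Function.surjInv hf (f x))
  rw [← sub_eq_zero, ← map_sub, ← smul_sub]
  refine hker q _ ?_
  rw [map_sub, Function.surjInv_eq hf, sub_self]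

section Tensor

variable {S : Type*} [Ring S] {X Y : Type*} [AddCommGroup X] [AddCommGroup Y]

variable (Q S X) in
/-- An `S`-module which is a `Q`-module is a `Q ⊗ S`-module. -/
@[reducible] def tensorModule [Module Q X] [Module S X] : Module (Q ⊗[ℤ] S) X :=
  have : SMulCommClass Q S X :=
    ⟨fun q s x => (AddMonoidHom.map_subring_smul (DistribSMul.toAddMonoidHom X s) q x).symm⟩
  TensorProduct.Algebra.module

theorem tensorModule_tmul_smul [Module Q X] [Module S X] (q : Q) (s : S) (x : X) :
    letI := tensorModule Q S X
    (q ⊗ₜ[ℤ] s : Q ⊗[ℤ] S) • x = q • s • x :=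
  have : SMulCommClass Q S X :=
    ⟨fun q s x => (AddMonoidHom.map_subring_smul (DistribSMul.toAddMonoidHom X s) q x).symm⟩
  TensorProduct.Algebra.smul_def q s x

variable (Q S X) in
/-- The `Q`-module underlying a `Q ⊗ S`-module. -/
abbrev leftModule [Module (Q ⊗[ℤ] S) X] : Module Q X :=
  Module.compHom X (Algebra.TensorProduct.includeLeftRingHom : Q →+* Q ⊗[ℤ] S)

theorem tensor_zero_smul [Module (Q ⊗[ℤ] S) X] (x : X) : (0 : Q ⊗[ℤ] S) • x = 0 :=
  zero_smul (Q ⊗[ℤ] S) x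

/-- Additive maps between `Q ⊗ S`-modules that commute with the action of `S` are linear. -/
theorem map_tensor_smul [Module (Q ⊗[ℤ] S) X] [Module (Q ⊗[ℤ] S) Y] (f : X →+ Y)
    (hf : ∀ (s : S) x, f (((1 : Q) ⊗ₜ[ℤ] s) • x) = ((1 : Q) ⊗ₜ[ℤ] s) • f x) (a : Q ⊗[ℤ] S)
    (x : X) : f (a • x) = a • f x := by
  let := leftModule Q S X
  let := leftModule Q S Y
  induction a with
  | zero => rw [tensor_zero_smul, tensor_zero_smul, map_zero]
  | add a b ha hb => rw [add_smul, map_add, ha, hb, add_smul]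
  | tmul q s =>
    have h1 : (q ⊗ₜ[ℤ] s : Q ⊗[ℤ] S) = (q ⊗ₜ 1) * (1 ⊗ₜ s) := by
      rw [Algebra.TensorProduct.tmul_mul_tmul, mul_one, one_mul]
    rw [h1, mul_smul, mul_smul, ← hf]
    exact f.map_subring_smul q _

end Tensor

end Subring

/-! ### Objects with `Q`-module values and the two restriction functors. -/

namespace MackeyModule

variable {G : Type u} [Group G] {R : GreenFunctor.{u, w} G} {Q : Subring ℚ}

/-- A morphism of Mackey modules that is bijective on all values is an isomorphism. -/
theorem isIso_of_bijective {M N : MackeyModule.{u, v, w} R} (f : M ⟶ N)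
    (hf : ∀ H, Function.Bijective (Hom.app f H)) : IsIso f := by
  let e : ∀ H, M.obj H ≃ₗ[R.obj H] N.obj H := fun H => LinearEquiv.ofBijective (Hom.app f H) (hf H)
  let g : Hom N M :=
    { app := fun H => (e H).symm.toLinearMap
      app_res := fun {K H} h m => (e K).symm_apply_eq.2 ((Hom.app_res f h _).trans
        (congrArg (N.str.res h) ((e H).apply_symm_apply m))).symm
      app_ind := fun {K H} h m => (e H).symm_apply_eq.2 ((Hom.app_ind f h _).trans
        (congrArg (N.str.ind h) ((e K).apply_symm_apply m))).symm
      app_conj := fun g {H K} h m => (e K).symm_apply_eq.2 ((Hom.app_conj f g h _).trans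
        (congrArg (N.str.conj g h) ((e H).apply_symm_apply m))).symm }
  exact ⟨g, hom_ext fun H m => (e H).symm_apply_apply m,
    hom_ext fun H m => (e H).apply_symm_apply m⟩

/-- Induction maps are additive, hence `Q`-linear, so the subgroup divided out is a `Q`-submodule.
-/
theorem nonempty_module_brauerQuotient (M : MackeyModule.{u, v, w} R)
    (hM : ∀ H, Nonempty (Module Q (M.obj H))) (H : Subgroup G) :
    Nonempty (Module Q (M.brauerQuotient H)) := by
  let := fun H => (hM H).some
  refine nonempty_module_of_surjective (M.brauerMk H) (M.brauerMk_surjective H) fun q m hm => ?_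
  rw [brauerMk_eq_zero_iff] at hm ⊢
  have h1 : M.str.inducedSubgroup H ≤ (M.str.inducedSubgroup H).comap
      (DistribSMul.toAddMonoidHom (M.obj H) q) := by
    refine M.str.inducedSubgroup_le fun K hK m => ?_
    rw [AddSubgroup.mem_comap, DistribSMul.toAddMonoidHom_apply, ← AddMonoidHom.map_subring_smul]
    exact M.str.ind_mem_inducedSubgroup hK _
  exact h1 hm

end MackeyModule

namespace GreenFunctor

variable {G : Type u} [Group G] {R : GreenFunctor.{u, w} G} {T : Set (Subgroup G)} {Q : Subring ℚ}

/-- The defining conditions are `Q`-linear, since `N_G(H)` acts on `V H` by additive maps. -/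
theorem nonempty_module_coind {V : ∀ H : T, ModuleCat.{v} (R.skewRing (H : Subgroup G))}
    (hV : ∀ H, Nonempty (Module Q (V H))) (K : Subgroup G) : Nonempty (Module Q (coind V K)) := by
  let := fun H => (hV H).some
  let P : Submodule Q (∀ H : T, G → V H) :=
    { coind V K with
      smul_mem' := by
        rintro q f ⟨h1, h2, h3⟩
        refine ⟨fun H y h => ?_, fun H y k hk => ?_, fun H y n => ?_⟩
        · rw [Pi.smul_apply, Pi.smul_apply, h1 H y h, smul_zero]
        · rw [Pi.smul_apply, Pi.smul_apply, Pi.smul_apply, h2 H y k hk]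
        · rw [Pi.smul_apply, Pi.smul_apply, Pi.smul_apply, h3 H y n]
          exact (AddMonoidHom.map_subring_smul
            (DistribSMul.toAddMonoidHom (V H) (R.normalizerHom (H : Subgroup G) n)) q _).symm }
  exact ⟨inferInstanceAs (Module Q P)⟩

section RestrictSkew

variable (R Q)

theorem nonempty_module_restrictSkew
    (V : ∀ H : T, ModuleCat.{v} (R.skewRingBaseChange Q (H : Subgroup G))) (H : T) :
    Nonempty (Module Q ((R.restrictSkew Q T).obj V H)) :=
  ⟨@leftModule Q (R.skewRing (H : Subgroup G)) _ (V H) _ (V H).isModule⟩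

/-- Restriction along `R̄(H) ⋊ W_G(H) → Q ⊗ (R̄(H) ⋊ W_G(H))` is fully faithful. -/
noncomputable def restrictSkewFullyFaithful (T : Set (Subgroup G)) :
    (R.restrictSkew.{u, v, w} Q T).FullyFaithful where
  preimage {V V'} f := fun H => ModuleCat.ofHom
    { toFun := (f H).hom
      map_add' := (f H).hom.map_add
      map_smul' := @map_tensor_smul Q (R.skewRing (H : Subgroup G)) _ (V H) (V' H) _ _
        (V H).isModule (V' H).isModule (f H).hom.toAddMonoidHom (f H).hom.map_smul }

/-- The action of the skew group ring commutes with that of `Q` and so extends to the tensor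
product; the identity map is the required isomorphism. -/
theorem essImage_restrictSkew (V : ∀ H : T, ModuleCat.{v} (R.skewRing (H : Subgroup G)))
    (hV : ∀ H, Nonempty (Module Q (V H))) : (R.restrictSkew Q T).essImage V := by
  let := fun H => (hV H).some
  let := fun H : T => tensorModule Q (R.skewRing (H : Subgroup G)) (V H)
  have hsmul : ∀ (H : T) (s : R.skewRing (H : Subgroup G)) (x : V H),
      ((1 : Q) ⊗ₜ[ℤ] s : Q ⊗[ℤ] R.skewRing (H : Subgroup G)) • x = s • x := fun H s x => by
    rw [tensorModule_tmul_smul, one_smul]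
  let W : ∀ H : T, ModuleCat.{v} (R.skewRingBaseChange Q (H : Subgroup G)) :=
    fun H => ModuleCat.of _ (V H)
  let φ : ∀ H : T, (R.restrictSkew Q T).obj W H →ₗ[R.skewRing (H : Subgroup G)] V H := fun H =>
    { toFun := id
      map_add' := fun _ _ => rfl
      map_smul' := fun s x => hsmul H s x }
  let f : (R.restrictSkew Q T).obj W ⟶ V := fun H =>
    ModuleCat.ofHom (X := (R.restrictSkew Q T).obj W H) (Y := V H) (φ H)
  have : IsIso f := (isIso_pi_iff _).2 fun H =>
    (ConcreteCategory.isIso_iff_bijective _).2 Function.bijective_id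
  exact ⟨_, ⟨asIso f⟩⟩

end RestrictSkew

variable [Finite G]

theorem nonempty_module_coindObj {V : ∀ H : T, ModuleCat.{v} (R.skewRing (H : Subgroup G))}
    (hV : ∀ H, Nonempty (Module Q (V H))) (K : Subgroup G) :
    Nonempty (Module Q ((coindObj V).obj K)) := by
  let := (nonempty_module_coind hV K).some
  refine nonempty_module_of_surjective (coindEquiv V K).symm.toLinearMap.toAddMonoidHom
    (coindEquiv V K).symm.surjective fun q f hf => ?_
  have h1 : f = 0 := (coindEquiv V K).symm.map_eq_zero_iff.1 hf
  rw [h1, smul_zero, map_zero]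

theorem inv_card_subgroup_mem (hQ : (Nat.card G : ℚ)⁻¹ ∈ Q)
    (K : Subgroup G) : (Nat.card K : ℚ)⁻¹ ∈ Q :=
  Subring.inv_natCast_mem_of_dvd hQ (Subgroup.card_subgroup_dvd_card K) Nat.card_pos.ne'

theorem exists_card_nsmul_eq_coind (hQ : (Nat.card G : ℚ)⁻¹ ∈ Q)
    {V : ∀ H : T, ModuleCat.{v} (R.skewRing (H : Subgroup G))}
    (hV : ∀ H, Nonempty (Module Q (V H))) (K : Subgroup G) (f : coind V K) :
    ∃ f', Nat.card K • f' = f := by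
  let := (nonempty_module_coind hV K).some
  exact exists_nsmul_eq_of_inv_mem (inv_card_subgroup_mem hQ K) Nat.card_pos.ne' f

theorem isIso_counit_app (hQ : (Nat.card G : ℚ)⁻¹ ∈ Q)
    (hT : ∀ K : Subgroup G, ∃! H : Subgroup G, H ∈ T ∧ ∃ g : G, MulAut.conj g • K = H)
    {V : ∀ H : T, ModuleCat.{v} (R.skewRing (H : Subgroup G))}
    (hV : ∀ H, Nonempty (Module Q (V H))) : IsIso ((brauerAdjunction R T).counit.app V) := by
  refine (isIso_pi_iff _).2 fun H => ?_
  rw [ConcreteCategory.isIso_iff_bijective]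
  exact counitMap_bijective hT H (exists_card_nsmul_eq_coind hQ hV H)

theorem isIso_unit_app (hQ : (Nat.card G : ℚ)⁻¹ ∈ Q)
    (hT : ∀ K : Subgroup G, ∃! H : Subgroup G, H ∈ T ∧ ∃ g : G, MulAut.conj g • K = H)
    {M : MackeyModule.{u, v, w} R} (hM : ∀ H, Nonempty (Module Q (M.obj H))) :
    IsIso ((brauerAdjunction R T).unit.app M) := by
  refine MackeyModule.isIso_of_bijective _ fun K => ?_
  refine (coindEquiv _ K).symm.bijective.comp (coindUnit_bijective hT M (fun K m hm => ?_)
    (exists_card_nsmul_eq_coind hQ fun H => M.nonempty_module_brauerQuotient hM H) K)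
  let := (hM K).some
  exact eq_zero_of_nsmul_eq_zero_of_inv_mem (inv_card_subgroup_mem hQ K) Nat.card_pos.ne' hm

variable (R Q)

theorem nonempty_module_restrictMackey (M : MackeyModule.{u, v, w} (R.baseChange Q))
    (H : Subgroup G) : Nonempty (Module Q (((R.restrictMackey Q).obj M).obj H)) :=
  ⟨@leftModule Q (R.obj H) _ (M.obj H) _ (M.module H)⟩

/-- Restriction of Mackey modules along `R → R_Q` is fully faithful. -/
def restrictMackeyFullyFaithful : (R.restrictMackey Q).FullyFaithful where
  preimage {M N} f :=
    { app H :=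
        { toFun := MackeyModule.Hom.app f H
          map_add' := (MackeyModule.Hom.app f H).map_add
          map_smul' := @map_tensor_smul Q (R.obj H) _ (M.obj H) (N.obj H) _ _ (M.module H)
            (N.module H) (MackeyModule.Hom.app f H).toAddMonoidHom
            (MackeyModule.Hom.app f H).map_smul }
      app_res := MackeyModule.Hom.app_res f
      app_ind := MackeyModule.Hom.app_ind f
      app_conj := MackeyModule.Hom.app_conj f }

/-- A Mackey `R`-module whose values are `Q`-modules is a Mackey `R_Q`-module. -/
def extendModule (M : MackeyModule.{u, v, w} R) [∀ H, Module Q (M.obj H)] :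
    MackeyModule.{u, v, w} (R.baseChange Q) where
  obj := M.obj
  module H := tensorModule Q (R.obj H) (M.obj H)
  str := M.str
  res_smul {K H} h r m := by
    let := fun H => tensorModule Q (R.obj H) (M.obj H)
    have key : ∀ a : Q ⊗[ℤ] R.obj H,
        M.str.res h (a • m) = tensorMap Q (R.str.res h) a • M.str.res h m := fun a => by
      induction a with
      | zero => simp only [tensor_zero_smul, map_zero]
      | add a b ha hb => simp only [add_smul, map_add, ha, hb]
      | tmul q r =>
        rw [tensorMap_tmul, tensorModule_tmul_smul, tensorModule_tmul_smul,
          AddMonoidHom.map_subring_smul, M.res_smul]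
    exact key r
  conj_smul g {H K} h r m := by
    let := fun H => tensorModule Q (R.obj H) (M.obj H)
    have key : ∀ a : Q ⊗[ℤ] R.obj H,
        M.str.conj g h (a • m) = tensorMap Q (R.str.conj g h) a • M.str.conj g h m := fun a => by
      induction a with
      | zero => simp only [tensor_zero_smul, map_zero]
      | add a b ha hb => simp only [add_smul, map_add, ha, hb]
      | tmul q r =>
        rw [tensorMap_tmul, tensorModule_tmul_smul, tensorModule_tmul_smul,
          AddMonoidHom.map_subring_smul, M.conj_smul]
    exact key r
  ind_res_smul {K H} h r m := by
    let := fun H => tensorModule Q (R.obj H) (M.obj H)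
    have key : ∀ a : Q ⊗[ℤ] R.obj H,
        M.str.ind h (tensorMap Q (R.str.res h) a • m) = a • M.str.ind h m := fun a => by
      induction a with
      | zero => simp only [tensor_zero_smul, map_zero]
      | add a b ha hb => simp only [add_smul, map_add, ha, hb]
      | tmul q r =>
        rw [tensorMap_tmul, tensorModule_tmul_smul, tensorModule_tmul_smul,
          AddMonoidHom.map_subring_smul, M.ind_res_smul]
    exact key r
  ind_smul_res {K H} h r m := by
    let := fun H => tensorModule Q (R.obj H) (M.obj H)
    have key : ∀ a : Q ⊗[ℤ] R.obj K,
        M.str.ind h (a • M.str.res h m) = tensorMap Q (R.str.ind h) a • m := fun a => by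
      induction a with
      | zero => simp only [tensor_zero_smul, map_zero]
      | add a b ha hb => simp only [add_smul, map_add, ha, hb]
      | tmul q r =>
        rw [tensorMap_tmul, tensorModule_tmul_smul, tensorModule_tmul_smul,
          AddMonoidHom.map_subring_smul, M.ind_smul_res]
    exact key r

theorem essImage_restrictMackey (M : MackeyModule.{u, v, w} R)
    (hM : ∀ H, Nonempty (Module Q (M.obj H))) : (R.restrictMackey Q).essImage M := by
  let := fun H => (hM H).some
  have hsmul : ∀ H (r : R.obj H) (m : M.obj H),
      letI := tensorModule Q (R.obj H) (M.obj H)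
      ((1 : Q) ⊗ₜ[ℤ] r : Q ⊗[ℤ] R.obj H) • m = r • m := fun H r m => by
    rw [tensorModule_tmul_smul, one_smul]
  let f : MackeyModule.Hom ((R.restrictMackey Q).obj (R.extendModule Q M)) M :=
    { app := fun H =>
        { toFun := id
          map_add' := fun _ _ => rfl
          map_smul' := fun r m => hsmul H r m }
      app_res := fun _ _ => rfl
      app_ind := fun _ _ => rfl
      app_conj := fun _ _ _ _ _ => rfl }
  have : IsIso (C := MackeyModule R) f :=
    MackeyModule.isIso_of_bijective _ fun _ => Function.bijective_id
  exact ⟨_, ⟨asIso (C := MackeyModule R) f⟩⟩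

end GreenFunctor

theorem theorem4p6 {G : Type u} [Group G] [Finite G] (R : GreenFunctor.{u, w} G)
    (T : Set (Subgroup G))
    (hT : ∀ K : Subgroup G, ∃! H : Subgroup G, H ∈ T ∧ ∃ g : G, MulAut.conj g • K = H) :
    ∃ (Φ : (∀ H : T, ModuleCat.{v} (R.skewRing (H : Subgroup G))) ⥤ MackeyModule.{u, v, w} R)
      (adj : MackeyModule.brauer R T ⊣ Φ),
      ∀ Q : Subring ℚ, (Nat.card G : ℚ)⁻¹ ∈ Q →
        ∃ (e : MackeyModule.{u, v, w} (R.baseChange Q) ≌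
              (∀ H : T, ModuleCat.{v} (R.skewRingBaseChange Q (H : Subgroup G))))
          (α : e.functor ⋙ R.restrictSkew Q T ≅ R.restrictMackey Q ⋙ MackeyModule.brauer R T)
          (β : e.inverse ⋙ R.restrictMackey Q ≅ R.restrictSkew Q T ⋙ Φ),
          (∀ M, (R.restrictMackey Q).map (e.unit.app M) ≫ β.hom.app (e.functor.obj M) ≫
              Φ.map (α.hom.app M) = adj.unit.app ((R.restrictMackey Q).obj M)) ∧
          (∀ V, (R.restrictSkew Q T).map (e.counit.app V) =
              α.hom.app (e.inverse.obj V) ≫ (MackeyModule.brauer R T).map (β.hom.app V) ≫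
                adj.counit.app ((R.restrictSkew Q T).obj V)) :=
  ⟨GreenFunctor.coindFunctor R T, GreenFunctor.brauerAdjunction R T, fun Q hQ =>
    Adjunction.exists_equivalence_of_fullyFaithful (R.restrictMackeyFullyFaithful Q)
      (R.restrictSkewFullyFaithful Q T) (GreenFunctor.brauerAdjunction R T)
      (fun M => R.essImage_restrictSkew Q _ fun H =>
        MackeyModule.nonempty_module_brauerQuotient _ (R.nonempty_module_restrictMackey Q M) H)
      (fun V => R.essImage_restrictMackey Q _ fun K =>
        GreenFunctor.nonempty_module_coindObj (R.nonempty_module_restrictSkew Q V) K)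
      (fun M => GreenFunctor.isIso_unit_app hQ hT (R.nonempty_module_restrictMackey Q M))
      fun V => GreenFunctor.isIso_counit_app hQ hT (R.nonempty_module_restrictSkew Q V)⟩
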